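/- Let $k\ge 3$ be a constant integer and set $p=k+\lfloor k^2/4\rfloor$. In $k$-Clique, the input is a $k$-partite graph $G$ with parts $V_1,\dots,V_k$ of $n\ge 1$ vertices each, and one has to decide whether $G$ contains $k$ mutually adjacent vertices. In $p$-DP (respectively $p$-DSP), the input is a directed graph with sources $s_1,\dots,s_p$ and targets $t_1,\dots,t_p$, and one has to decide whether it contains internally vertex-disjoint $(s_i,t_i)$-paths (respectively internally vertex-disjoint shortest $(s_i,t_i)$-paths), $i=1,\dots,p$. Then there are a reduction from $k$-Clique to $p$-DP and a reduction from $k$-Clique to $p$-DSP, each running in $O((kn)^2)$ time on a word-RAM with words of $O(\log n)$ bits, which map $G$ to an unweighted directed acyclic graph with $O(kn)$ vertices and $2p$ distinct terminals $s_1,\dots,s_p,t_1,\dots,t_p$, such that $G$ has a $k$-clique if and only if the resulting instance is a yes-instance. The constants hidden in the $O(\cdot)$ may depend on the constant $k$. Graphs are given by adjacency matrices. -/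

import Mathlib

/-! ### Word-RAM programs

A word-RAM with words of `w` bits: registers and memory cells hold natural numbers below `2 ^ w`,
arithmetic is modulo `2 ^ w`, memory is addressed by words (indirect addressing), and every
operation on words takes one step. Control flow is structured (sequencing, conditionals, loops). -/

namespace WordRAM

/-- Binary operations on words. Comparisons return `1` (true) or `0` (false). -/
inductive BinOp : Type
  | add | sub | mul | div | mod | land | lor | lxor | shl | shr | lt | eq

/-- The result of a binary operation on words of `w` bits. -/
def BinOp.eval (w : ℕ) : BinOp → ℕ → ℕ → ℕ
  | .add, a, b => (a + b) % 2 ^ w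
  | .sub, a, b => (a + (2 ^ w - b)) % 2 ^ w
  | .mul, a, b => (a * b) % 2 ^ w
  | .div, a, b => (a / b) % 2 ^ w
  | .mod, a, b => (a % b) % 2 ^ w
  | .land, a, b => (a &&& b) % 2 ^ w
  | .lor, a, b => (a ||| b) % 2 ^ w
  | .lxor, a, b => (a ^^^ b) % 2 ^ w
  | .shl, a, b => (a <<< b) % 2 ^ w
  | .shr, a, b => (a >>> b) % 2 ^ w
  | .lt, a, b => (if a < b then 1 else 0) % 2 ^ w
  | .eq, a, b => (if a = b then 1 else 0) % 2 ^ w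

/-- Registers and memory. -/
structure State : Type where
  reg : ℕ → ℕ
  mem : ℕ → ℕ

/-- Expressions: literals, registers, memory cells (`load e` reads the cell whose address is the
value of `e`), binary operations. -/
inductive Expr : Type
  | lit (a : ℕ)
  | reg (r : ℕ)
  | load (e : Expr)
  | bin (op : BinOp) (e₁ e₂ : Expr)

/-- The value of an expression in a state. -/
def Expr.eval (w : ℕ) (σ : State) : Expr → ℕ
  | .lit a => a % 2 ^ w
  | .reg r => σ.reg r
  | .load e => σ.mem (e.eval w σ)
  | .bin op e₁ e₂ => op.eval w (e₁.eval w σ) (e₂.eval w σ)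

/-- The number of steps for evaluating an expression: one for each of its nodes. -/
def Expr.cost : Expr → ℕ
  | .lit _ => 1
  | .reg _ => 1
  | .load e => e.cost + 1
  | .bin _ e₁ e₂ => e₁.cost + e₂.cost + 1

/-- Programs. `store e₁ e₂` writes the value of `e₂` to the memory cell with address `e₁`;
a condition is true if its value is not `0`. -/
inductive Cmd : Type
  | skip
  | assign (r : ℕ) (e : Expr)
  | store (e₁ e₂ : Expr)
  | seq (c₁ c₂ : Cmd)
  | cond (e : Expr) (c₁ c₂ : Cmd)
  | loop (e : Expr) (c : Cmd)

/-- Write the value `a` to register `r`. -/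
def State.setReg (σ : State) (r a : ℕ) : State :=
  { σ with reg := Function.update σ.reg r a }

/-- Write the value `b` to the memory cell with address `a`. -/
def State.setMem (σ : State) (a b : ℕ) : State :=
  { σ with mem := Function.update σ.mem a b }

/-- `Runs w c σ σ' t`: with words of `w` bits, the program `c` started in the state `σ` halts in the
state `σ'` after exactly `t` steps. -/
inductive Runs (w : ℕ) : Cmd → State → State → ℕ → Prop
  | skip (σ : State) : Runs w .skip σ σ 1
  | assign (r : ℕ) (e : Expr) (σ : State) :
      Runs w (.assign r e) σ (σ.setReg r (e.eval w σ)) (e.cost + 1)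
  | store (e₁ e₂ : Expr) (σ : State) :
      Runs w (.store e₁ e₂) σ (σ.setMem (e₁.eval w σ) (e₂.eval w σ)) (e₁.cost + e₂.cost + 1)
  | seq {c₁ c₂ : Cmd} {σ σ₁ σ₂ : State} {t₁ t₂ : ℕ} :
      Runs w c₁ σ σ₁ t₁ → Runs w c₂ σ₁ σ₂ t₂ → Runs w (.seq c₁ c₂) σ σ₂ (t₁ + t₂)
  | cond_true {e : Expr} {c₁ c₂ : Cmd} {σ σ' : State} {t : ℕ} :
      e.eval w σ ≠ 0 → Runs w c₁ σ σ' t → Runs w (.cond e c₁ c₂) σ σ' (e.cost + 1 + t)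
  | cond_false {e : Expr} {c₁ c₂ : Cmd} {σ σ' : State} {t : ℕ} :
      e.eval w σ = 0 → Runs w c₂ σ σ' t → Runs w (.cond e c₁ c₂) σ σ' (e.cost + 1 + t)
  | loop_true {e : Expr} {c : Cmd} {σ σ₁ σ₂ : State} {t₁ t₂ : ℕ} :
      e.eval w σ ≠ 0 → Runs w c σ σ₁ t₁ → Runs w (.loop e c) σ₁ σ₂ t₂ →
        Runs w (.loop e c) σ σ₂ (e.cost + 1 + t₁ + t₂)
  | loop_false {e : Expr} {c : Cmd} {σ : State} :
      e.eval w σ = 0 → Runs w (.loop e c) σ σ (e.cost + 1)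

end WordRAM

/-! ### Disjoint paths in unweighted directed graphs -/

/-- `l` is the vertex sequence of a directed path from `s` to `t` in `G`. -/
def Digraph.IsPathFromTo {V : Type*} (G : Digraph V) (s t : V) (l : List V) : Prop :=
  l.IsChain G.Adj ∧ l.Nodup ∧ l.head? = some s ∧ l.getLast? = some t

/-- `l` is a path from `s` to `t` with the fewest edges, equivalently the fewest vertices. -/
def Digraph.IsShortestPathFromTo {V : Type*} (G : Digraph V) (s t : V) (l : List V) : Prop :=
  G.IsPathFromTo s t l ∧ ∀ l' : List V, G.IsPathFromTo s t l' → l.length ≤ l'.length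

/-- A directed graph without directed cycles (in particular without loops). -/
def Digraph.IsDAG {V : Type*} (G : Digraph V) : Prop :=
  ∀ v : V, ¬ Relation.TransGen G.Adj v v

/-- A family of paths, given by their vertex sequences, is internally vertex-disjoint: no internal
vertex of one path lies on another path. -/
def InternallyDisjoint {V ι : Type*} (P : ι → List V) : Prop :=
  ∀ i j : ι, i ≠ j → ∀ v ∈ (P i).tail.dropLast, v ∉ P j

/-- An unweighted directed graph with vertices `0, …, N - 1` and with `p` sources and
`p` targets. -/
structure DPInstance (p : ℕ) : Type where
  N : ℕ
  G : Digraph (Fin N)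
  s : Fin p → Fin N
  t : Fin p → Fin N

namespace DPInstance

variable {p : ℕ}

/-- The `p` sources and the `p` targets are `2 * p` different vertices. -/
def DistinctTerminals (I : DPInstance p) : Prop :=
  Function.Injective (Sum.elim I.s I.t)

/-- The yes-instances of the `p`-Disjoint Paths problem. -/
def HasDisjointPaths (I : DPInstance p) : Prop :=
  ∃ P : Fin p → List (Fin I.N),
    (∀ i, I.G.IsPathFromTo (I.s i) (I.t i) (P i)) ∧ InternallyDisjoint P

/-- The yes-instances of the `p`-Disjoint Shortest Paths problem. -/
def HasDisjointShortestPaths (I : DPInstance p) : Prop :=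
  ∃ P : Fin p → List (Fin I.N),
    (∀ i, I.G.IsShortestPathFromTo (I.s i) (I.t i) (P i)) ∧ InternallyDisjoint P

open Classical in
/-- The instance `I` is stored in the memory of a machine with words of `w` bits, from the address
`b` on: the number of vertices, the adjacency matrix (row by row), the sources, the targets. -/
def StoredAt (I : DPInstance p) (w : ℕ) (mem : ℕ → ℕ) (b : ℕ) : Prop :=
  b + 1 + I.N * I.N + 2 * p ≤ 2 ^ w ∧
  mem b = I.N ∧
  (∀ u v : Fin I.N, mem (b + 1 + (u * I.N + v)) = if I.G.Adj u v then 1 else 0) ∧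
  (∀ i : Fin p, mem (b + 1 + I.N * I.N + i) = I.s i) ∧
  (∀ i : Fin p, mem (b + 1 + I.N * I.N + p + i) = I.t i)

end DPInstance

/-! ### The `k`-Clique problem and reductions from it -/

/-- `G` is `k`-partite with the parts `V_i = {(i, a) : a < n}`: no edge joins two vertices of
the same part. -/
def IsPartiteByFst {k n : ℕ} (G : SimpleGraph (Fin k × Fin n)) : Prop :=
  ∀ u v : Fin k × Fin n, G.Adj u v → u.1 ≠ v.1

open Classical in
/-- The start state on the input `G`: cell `0` holds `n`, then follows the adjacency matrix of `G`
(row by row, the vertex `(i, a)` having the number `i * n + a`); everything else is `0`. -/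
noncomputable def cliqueInput {k n : ℕ} (G : SimpleGraph (Fin k × Fin n)) : WordRAM.State where
  reg := fun _ => 0
  mem := fun x =>
    if x = 0 then n
    else if ∃ u v : Fin k × Fin n, G.Adj u v ∧
        x = 1 + ((u.1 * n + u.2) * (k * n) + (v.1 * n + v.2)) then 1
    else 0

/-- For fixed `k` and `p`, there is a reduction from `k`-Clique, on `k`-partite graphs with `n`
vertices in each part, to the problem with the yes-instances `Q` on unweighted DAGs with `O(k n)`
vertices, which runs in `O((k n) ^ 2)` time on a word-RAM with words of `O(log n)` bits. The final
value of register `0` is the address of the output. -/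
def CliqueReducesTo (k p : ℕ) (Q : DPInstance p → Prop) : Prop :=
  ∃ (prog : WordRAM.Cmd) (c C : ℕ),
    ∀ n : ℕ, 1 ≤ n → ∀ w : ℕ, c * (Nat.log 2 n + 1) ≤ w →
      ∀ G : SimpleGraph (Fin k × Fin n), IsPartiteByFst G →
        ∃ (σ : WordRAM.State) (T : ℕ) (I : DPInstance p),
          WordRAM.Runs w prog (cliqueInput G) σ T ∧
          T ≤ C * (k * n) ^ 2 ∧
          I.StoredAt w σ.mem (σ.reg 0) ∧
          I.N ≤ C * (k * n) ∧
          I.G.IsDAG ∧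
          I.DistinctTerminals ∧
          ((∃ S : Finset (Fin k × Fin n), G.IsNClique k S) ↔ Q I)

/-! ### Layered templates -/

/-! The instance has k selector paths, one per part, and m = ⌊k²/4⌋ check paths. The selector path
of part i sweeps the positions (column c, level l), with one level for each check path. It occupies
row `inn` up to some column and row `out` after it, so at most one column can be crossed from `inn`
to `out`. This free column is the selected vertex of part i (`exists_selected`). A check path passes
all parts in order and can cross only in selected columns. Some of its arcs exist only if the
selected vertices of two parts are adjacent in the input.

One check path tests many pairs. A pair i < j consists of consecutive terms of the progression with
difference d = j - i and start i mod d, and exactly ⌊k²/4⌋ such progressions have two terms below k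
(`exists_chains`). A check path crosses the parts on its progression. It carries the last selected
column past the other parts on the rows `cin` and `cout`, so that it can be compared with the next
term.

Soundness needs only disjoint paths. A check path that enters a part behind the selected column
cannot reach a free `out` vertex, and one that rises to a higher level in the selected column never
comes down again. A path that ends at its own target has therefore kept its level and made all its
tests (`checked_of_path`). Conversely, a clique yields disjoint paths, which are shortest because a
potential grows by exactly one along each of them and by at most one on every arc
(`selector_isShortest`, `check_isShortest`). Row `mid` serves this purpose: it lets the selector
path step aside in the selected column without changing its length.

Hence clique ⇒ disjoint shortest paths ⇒ disjoint paths ⇒ clique, and one instance serves both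
problems. For fixed k there are constantly many rows and arc types, so each matrix entry costs
constant time (`exists_templateProg`). -/

/-- A relation between the columns of two vertices. -/
inductive ColRel (k : ℕ) : Type
  | all | same | succ | fst | lst
  | adj (i j : Fin k)

/-- The meaning of a column relation for the input graph `G`. -/
def ColRel.Holds {k n : ℕ} (G : SimpleGraph (Fin k × Fin n)) : ColRel k → Fin n → Fin n → Prop
  | .all, _, _ => True
  | .same, c, c' => c = c'
  | .succ, c, c' => c.val + 1 = c'.val
  | .fst, _, c' => c'.val = 0
  | .lst, c, _ => c.val + 1 = n
  | .adj i j, c, c' => G.Adj (i, c) (j, c')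

/-- The instance with `L` rows of `n` vertices whose arcs are given by the column relations in `E`,
the terminals being the first vertices of the rows `s i` and `t i`. -/
def templateInstance {k p L : ℕ} (E : List (Fin L × Fin L × ColRel k)) (s t : Fin p → Fin L)
    {n : ℕ} (hn : 0 < n) (G : SimpleGraph (Fin k × Fin n)) : DPInstance p where
  N := L * n
  G := { Adj := fun u v => ∃ e ∈ E, e.1 = u.divNat ∧ e.2.1 = v.divNat ∧
          e.2.2.Holds G u.modNat v.modNat }
  s i := finProdFinEquiv (s i, ⟨0, hn⟩)
  t i := finProdFinEquiv (t i, ⟨0, hn⟩)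

/-! ### Evaluating the arcs of a template with machine words -/

namespace WordRAM

open Classical in
/-- The truth value of a proposition as a word. -/
noncomputable def truth (P : Prop) : ℕ := if P then 1 else 0

theorem ite_eq_truth (P : Prop) [Decidable P] : (if P then 1 else 0) = truth P := by
  unfold truth
  congr

theorem truth_mod {w : ℕ} (hw : 2 ≤ 2 ^ w) (P : Prop) : truth P % 2 ^ w = truth P :=
  Nat.mod_eq_of_lt (by unfold truth; split_ifs <;> omega)

theorem truth_lor (P Q : Prop) : truth P ||| truth Q = truth (P ∨ Q) := by
  by_cases p : P <;> by_cases q : Q <;> simp [truth, p, q]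

theorem truth_land (P Q : Prop) : truth P &&& truth Q = truth (P ∧ Q) := by
  by_cases p : P <;> by_cases q : Q <;> simp [truth, p, q]

/-- The disjunction of a list of expressions. -/
def orList {α : Type*} (f : α → Expr) : List α → Expr
  | [] => .lit 0
  | x :: l => .bin .lor (f x) (orList f l)

theorem eval_orList {α : Type*} {w : ℕ} (hw : 2 ≤ 2 ^ w) (σ : State) (f : α → Expr) (P : α → Prop)
    (l : List α) (h : ∀ x ∈ l, (f x).eval w σ = truth (P x)) :
    (orList f l).eval w σ = truth (∃ x ∈ l, P x) := by
  induction l with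
  | nil => simp [orList, Expr.eval, truth]
  | cons x l ih =>
    simp only [orList, Expr.eval, BinOp.eval, h x (by simp), ih fun y hy => h y (by simp [hy]),
      List.mem_cons, exists_eq_or_imp, truth_lor, truth_mod hw]

/-- The expression for a column relation, the columns being in the registers `7` and `8`. -/
def relExpr {k : ℕ} : ColRel k → Expr
  | .all => .lit 1
  | .same => .bin .eq (.reg 7) (.reg 8)
  | .succ => .bin .eq (.bin .add (.reg 7) (.lit 1)) (.reg 8)
  | .fst => .bin .eq (.reg 8) (.lit 0)
  | .lst => .bin .eq (.bin .add (.reg 7) (.lit 1)) (.reg 1)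
  | .adj i j =>
    .load (.bin .add (.lit 1) (.bin .add
      (.bin .mul (.bin .add (.bin .mul (.lit i) (.reg 1)) (.reg 7)) (.bin .mul (.lit k) (.reg 1)))
      (.bin .add (.bin .mul (.lit j) (.reg 1)) (.reg 8))))

/-- The expression for one arc of a template, the rows being in the registers `5` and `6`. -/
def arcExpr {k L : ℕ} (e : Fin L × Fin L × ColRel k) : Expr :=
  .bin .land (.bin .eq (.reg 5) (.lit e.1))
    (.bin .land (.bin .eq (.reg 6) (.lit e.2.1)) (relExpr e.2.2))

theorem mul_add_lt_mul {a b x y : ℕ} (hx : x < a) (hy : y < b) : x * b + y < a * b := by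
  have : (x + 1) * b ≤ a * b := Nat.mul_le_mul_right _ hx
  nlinarith

theorem cliqueInput_mem_zero {k n : ℕ} (G : SimpleGraph (Fin k × Fin n)) :
    (cliqueInput G).mem 0 = n := by
  simp [cliqueInput]

/-- Addresses are mixed-radix numerals with digits i, c, j, c', so different pairs of vertices have
different cells. -/
theorem cliqueInput_mem_adj {k n : ℕ} (G : SimpleGraph (Fin k × Fin n)) (i j : Fin k)
    (c c' : Fin n) :
    (cliqueInput G).mem (1 + ((i * n + c) * (k * n) + (j * n + c'))) =
      truth (G.Adj (i, c) (j, c')) := by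
  have inj : ∀ {b x y x' y' : ℕ}, y < b → y' < b → x * b + y = x' * b + y' → x = x' ∧ y = y' := by
    intro b x y x' y' hy hy' h
    have hb : 0 < b := by omega
    have h1 := congrArg (· / b) h
    have h2 := congrArg (· % b) h
    simp only [mul_comm _ b, Nat.mul_add_mod, Nat.mul_add_div hb, Nat.div_eq_of_lt hy,
      Nat.div_eq_of_lt hy', Nat.mod_eq_of_lt hy, Nat.mod_eq_of_lt hy'] at h1 h2
    omega
  have key : (∃ u v : Fin k × Fin n, G.Adj u v ∧
      1 + ((i * n + c) * (k * n) + (j * n + c')) =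
        1 + ((u.1 * n + u.2) * (k * n) + (v.1 * n + v.2))) ↔ G.Adj (i, c) (j, c') := by
    constructor
    · rintro ⟨⟨u1, u2⟩, ⟨v1, v2⟩, ha, h⟩
      obtain ⟨h1, h2⟩ := inj (mul_add_lt_mul j.2 c'.2) (mul_add_lt_mul v1.2 v2.2)
        (Nat.add_left_cancel h)
      obtain ⟨h3, h4⟩ := inj c.2 u2.2 h1
      obtain ⟨h5, h6⟩ := inj c'.2 v2.2 h2
      rw [Fin.ext h3, Fin.ext h4, Fin.ext h5, Fin.ext h6]
      exact ha
    · intro h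
      exact ⟨_, _, h, rfl⟩
  simp only [cliqueInput]
  rw [if_neg (by omega), ite_eq_truth, key]

/-- The registers and the memory while the output is produced, for words that are large enough. -/
structure Frame (k L n w p : ℕ) (μ : ℕ → ℕ) (σ : State) : Prop where
  npos : 0 < n
  Lpos : 0 < L
  bound : 1 + (k * n) * (k * n) + 1 + (L * n) * (L * n) + 2 * p ≤ 2 ^ w
  reg0 : σ.reg 0 = 1 + (k * n) * (k * n)
  reg1 : σ.reg 1 = n
  reg2 : σ.reg 2 = L * n
  reg3 : σ.reg 3 = (L * n) * (L * n)
  mem : ∀ x < 1 + (k * n) * (k * n), σ.mem x = μ x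
  memN : σ.mem (1 + (k * n) * (k * n)) = L * n

/-- By the bound in `Frame` no intermediate value reaches 2 ^ w, so word arithmetic is exact. Only
`adj` reads memory, in a cell below the output that still holds the input. -/
theorem eval_relExpr {k L n w p : ℕ} {G : SimpleGraph (Fin k × Fin n)} {σ : State}
    (h : Frame k L n w p (cliqueInput G).mem σ) {c c' : Fin n} (h7 : σ.reg 7 = c)
    (h8 : σ.reg 8 = c') (R : ColRel k) :
    (relExpr R).eval w σ = truth (R.Holds G c c') := by
  have hb := h.bound
  have hL : 1 * n ≤ L * n := Nat.mul_le_mul_right _ h.Lpos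
  have hLL : 1 * (L * n) ≤ (L * n) * (L * n) :=
    Nat.mul_le_mul_right _ (Nat.mul_pos h.Lpos h.npos)
  have hc := c.2
  have hc' := c'.2
  have e1 : (1 : ℕ) % 2 ^ w = 1 := Nat.mod_eq_of_lt (by omega)
  have hw : 2 ≤ 2 ^ w := by omega
  have e2 : (c.val + 1) % 2 ^ w = c + 1 := Nat.mod_eq_of_lt (by omega)
  cases R with
  | all => simp [relExpr, Expr.eval, ColRel.Holds, e1, truth]
  | same =>
    simp only [relExpr, Expr.eval, BinOp.eval, ColRel.Holds, h7, h8, Fin.ext_iff, ite_eq_truth,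
      truth_mod hw]
  | succ =>
    simp only [relExpr, Expr.eval, BinOp.eval, ColRel.Holds, h7, h8, e1, e2, ite_eq_truth,
      truth_mod hw]
  | fst =>
    simp only [relExpr, Expr.eval, BinOp.eval, ColRel.Holds, h8, Nat.zero_mod, ite_eq_truth,
      truth_mod hw]
  | lst =>
    simp only [relExpr, Expr.eval, BinOp.eval, ColRel.Holds, h7, h.reg1, e1, e2, ite_eq_truth,
      truth_mod hw]
  | adj i j =>
    have hi := mul_add_lt_mul i.2 hc
    have hj := mul_add_lt_mul j.2 hc'
    have hij := mul_add_lt_mul hi hj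
    have hkn : 1 * (k * n) ≤ (k * n) * (k * n) :=
      Nat.mul_le_mul_right _ (Nat.mul_pos i.pos h.npos)
    have hk : k * 1 ≤ k * n := Nat.mul_le_mul_left _ h.npos
    have f1 : i.val % 2 ^ w = i := Nat.mod_eq_of_lt (by have := i.2; omega)
    have f2 : j.val % 2 ^ w = j := Nat.mod_eq_of_lt (by have := j.2; omega)
    have f3 : k % 2 ^ w = k := Nat.mod_eq_of_lt (by omega)
    have f4 : (i.val * n) % 2 ^ w = i * n := Nat.mod_eq_of_lt (by omega)
    have f5 : (j.val * n) % 2 ^ w = j * n := Nat.mod_eq_of_lt (by omega)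
    have f6 : (k * n) % 2 ^ w = k * n := Nat.mod_eq_of_lt (by omega)
    have f7 : (i.val * n + c) % 2 ^ w = i * n + c := Nat.mod_eq_of_lt (by omega)
    have f8 : (j.val * n + c') % 2 ^ w = j * n + c' := Nat.mod_eq_of_lt (by omega)
    have f9 : ((i.val * n + c) * (k * n)) % 2 ^ w = (i * n + c) * (k * n) :=
      Nat.mod_eq_of_lt (by omega)
    have f10 : ((i.val * n + c) * (k * n) + (j * n + c')) % 2 ^ w =
      (i * n + c) * (k * n) + (j * n + c') := Nat.mod_eq_of_lt (by omega)
    have f11 : (1 + ((i.val * n + c) * (k * n) + (j * n + c'))) % 2 ^ w =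
      1 + ((i * n + c) * (k * n) + (j * n + c')) := Nat.mod_eq_of_lt (by omega)
    simp only [relExpr, Expr.eval, BinOp.eval, ColRel.Holds, h7, h8, h.reg1, e1, f1, f2, f3, f4,
      f5, f6, f7, f8, f9, f10, f11]
    rw [h.mem _ (by omega), cliqueInput_mem_adj]

theorem eval_arcs {k L n w p : ℕ} {G : SimpleGraph (Fin k × Fin n)} {σ : State}
    (h : Frame k L n w p (cliqueInput G).mem σ) {a a' : Fin L} {c c' : Fin n} (h5 : σ.reg 5 = a)
    (h6 : σ.reg 6 = a') (h7 : σ.reg 7 = c) (h8 : σ.reg 8 = c')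
    (E : List (Fin L × Fin L × ColRel k)) :
    (orList arcExpr E).eval w σ =
      truth (∃ e ∈ E, e.1 = a ∧ e.2.1 = a' ∧ e.2.2.Holds G c c') := by
  have hb := h.bound
  have hL : L * 1 ≤ L * n := Nat.mul_le_mul_left _ h.npos
  have hLL : 1 * (L * n) ≤ (L * n) * (L * n) :=
    Nat.mul_le_mul_right _ (Nat.mul_pos h.Lpos h.npos)
  have hw : 2 ≤ 2 ^ w := by omega
  apply eval_orList hw
  rintro ⟨x, y, R⟩ -
  have f1 : x.val % 2 ^ w = x := Nat.mod_eq_of_lt (by omega)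
  have f2 : y.val % 2 ^ w = y := Nat.mod_eq_of_lt (by omega)
  simp only [arcExpr, Expr.eval, BinOp.eval, h5, h6, f1, f2, eval_relExpr h h7 h8, Fin.ext_iff,
    eq_comm (b := a.val), eq_comm (b := a'.val), ite_eq_truth, truth_land, truth_mod hw]

end WordRAM

/-! ### The program that writes a template instance, and its running time -/

namespace WordRAM

/-- Computes the start of the output, and writes the number of vertices. -/
def setupProg (k L : ℕ) : Cmd :=
  .seq (.assign 1 (.load (.lit 0)))
    (.seq (.assign 2 (.bin .mul (.lit L) (.reg 1)))
      (.seq (.assign 3 (.bin .mul (.reg 2) (.reg 2)))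
        (.seq (.assign 0 (.bin .add (.lit 1)
            (.bin .mul (.bin .mul (.lit k) (.reg 1)) (.bin .mul (.lit k) (.reg 1)))))
          (.store (.reg 0) (.reg 2)))))

/-- Writes the entry of the adjacency matrix with the number given by register `4`. -/
def entryProg {k L : ℕ} (E : List (Fin L × Fin L × ColRel k)) : Cmd :=
  .seq (.assign 5 (.bin .div (.bin .div (.reg 4) (.reg 2)) (.reg 1)))
    (.seq (.assign 6 (.bin .div (.bin .mod (.reg 4) (.reg 2)) (.reg 1)))
      (.seq (.assign 7 (.bin .mod (.bin .div (.reg 4) (.reg 2)) (.reg 1)))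
        (.seq (.assign 8 (.bin .mod (.bin .mod (.reg 4) (.reg 2)) (.reg 1)))
          (.seq (.store (.bin .add (.bin .add (.reg 0) (.lit 1)) (.reg 4)) (orList arcExpr E))
            (.assign 4 (.bin .add (.reg 4) (.lit 1)))))))

/-- Writes the adjacency matrix. -/
def matrixProg {k L : ℕ} (E : List (Fin L × Fin L × ColRel k)) : Cmd :=
  .loop (.bin .lt (.reg 4) (.reg 3)) (entryProg E)

/-- Writes the first vertices of the rows `f 0, …, f (j - 1)` behind the adjacency matrix. -/
def terminalProg (f : ℕ → ℕ) : ℕ → Cmd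
  | 0 => .skip
  | j + 1 => .seq (terminalProg f j)
      (.store (.bin .add (.bin .add (.bin .add (.reg 0) (.lit 1)) (.reg 3)) (.lit j))
        (.bin .mul (.lit (f j)) (.reg 1)))

theorem Runs.assign_of {w r : ℕ} {e : Expr} {σ : State} {a t : ℕ} (he : e.eval w σ = a)
    (ht : e.cost + 1 = t) : Runs w (.assign r e) σ (σ.setReg r a) t := by
  subst he ht
  exact .assign r e σ

theorem Runs.store_of {w : ℕ} {e₁ e₂ : Expr} {σ : State} {a b t : ℕ} (h₁ : e₁.eval w σ = a)
    (h₂ : e₂.eval w σ = b) (ht : e₁.cost + e₂.cost + 1 = t) :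
    Runs w (.store e₁ e₂) σ (σ.setMem a b) t := by
  subst h₁ h₂ ht
  exact .store e₁ e₂ σ

theorem Runs.cast {w : ℕ} {c : Cmd} {σ σ' : State} {t t' : ℕ} (h : Runs w c σ σ' t)
    (ht : t = t') : Runs w c σ σ' t' :=
  ht ▸ h

theorem Frame.congr {k L n w p : ℕ} {μ : ℕ → ℕ} {σ σ' : State} (h : Frame k L n w p μ σ)
    (hr : ∀ r < 4, σ'.reg r = σ.reg r)
    (hm : ∀ x ≤ 1 + (k * n) * (k * n), σ'.mem x = σ.mem x) : Frame k L n w p μ σ' where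
  npos := h.npos
  Lpos := h.Lpos
  bound := h.bound
  reg0 := by rw [hr 0 (by omega), h.reg0]
  reg1 := by rw [hr 1 (by omega), h.reg1]
  reg2 := by rw [hr 2 (by omega), h.reg2]
  reg3 := by rw [hr 3 (by omega), h.reg3]
  mem x hx := by rw [hm x (by omega), h.mem x hx]
  memN := by rw [hm _ le_rfl, h.memN]

theorem runs_setupProg {k L n w p : ℕ} (hn : 0 < n) (hL : 0 < L) (hk : 0 < k)
    (hb : 1 + (k * n) * (k * n) + 1 + (L * n) * (L * n) + 2 * p ≤ 2 ^ w)
    (G : SimpleGraph (Fin k × Fin n)) :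
    ∃ σ, Runs w (setupProg k L) (cliqueInput G) σ 24 ∧
      Frame k L n w p (cliqueInput G).mem σ ∧ σ.reg 4 = 0 := by
  have hL1 : L * 1 ≤ L * n := Nat.mul_le_mul_left _ hn
  have hLL : 1 * (L * n) ≤ (L * n) * (L * n) := Nat.mul_le_mul_right _ (Nat.mul_pos hL hn)
  have hk1 : k * 1 ≤ k * n := Nat.mul_le_mul_left _ hn
  have hkk : 1 * (k * n) ≤ (k * n) * (k * n) := Nat.mul_le_mul_right _ (Nat.mul_pos hk hn)
  have e0 : L % 2 ^ w = L := Nat.mod_eq_of_lt (by omega)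
  have e1 : (1 : ℕ) % 2 ^ w = 1 := Nat.mod_eq_of_lt (by omega)
  have e2 : k % 2 ^ w = k := Nat.mod_eq_of_lt (by omega)
  have e3 : (k * n) % 2 ^ w = k * n := Nat.mod_eq_of_lt (by omega)
  have e4 : (L * n) % 2 ^ w = L * n := Nat.mod_eq_of_lt (by omega)
  have e5 : ((k * n) * (k * n)) % 2 ^ w = (k * n) * (k * n) := Nat.mod_eq_of_lt (by omega)
  have e6 : ((L * n) * (L * n)) % 2 ^ w = (L * n) * (L * n) := Nat.mod_eq_of_lt (by omega)
  have e7 : (1 + (k * n) * (k * n)) % 2 ^ w = 1 + (k * n) * (k * n) :=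
    Nat.mod_eq_of_lt (by omega)
  refine ⟨_, (Runs.seq (.assign _ _ _) (.seq (.assign _ _ _) (.seq (.assign _ _ _)
    (.seq (.assign _ _ _) (.store _ _ _))))).cast rfl, ⟨hn, hL, hb, ?_, ?_, ?_, ?_, ?_, ?_⟩, ?_⟩
  all_goals simp only [State.setReg, State.setMem, Expr.eval, BinOp.eval, Function.update_apply,
    Nat.zero_mod, cliqueInput_mem_zero]
  all_goals norm_num [e0, e1, e2, e3, e4, e5, e6, e7]
  · intro x hx h
    omega
  · rfl

/-- Division by L * n splits the entry number into its two vertices, and division by n splits each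
vertex into row and column. The cost depends on the template only, not on n. -/
theorem runs_entryProg {k L n w p : ℕ} {G : SimpleGraph (Fin k × Fin n)} {σ : State}
    (h : Frame k L n w p (cliqueInput G).mem σ) (E : List (Fin L × Fin L × ColRel k))
    {u v : Fin (L * n)} (hx : σ.reg 4 = u * (L * n) + v) :
    ∃ σ', Runs w (entryProg E) σ σ' (34 + (orList arcExpr E).cost) ∧
      Frame k L n w p (cliqueInput G).mem σ' ∧ σ'.reg 4 = u * (L * n) + v + 1 ∧
      σ'.mem = Function.update σ.mem (1 + (k * n) * (k * n) + 1 + (u * (L * n) + v))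
        (truth (∃ e ∈ E, e.1 = u.divNat ∧ e.2.1 = v.divNat ∧
          e.2.2.Holds G u.modNat v.modNat)) := by
  have hb := h.bound
  have hN : 0 < L * n := Nat.mul_pos h.Lpos h.npos
  have hLL : 1 * (L * n) ≤ (L * n) * (L * n) := Nat.mul_le_mul_right _ hN
  have huv := mul_add_lt_mul u.2 v.2
  have d1 : (u * (L * n) + v.val) / (L * n) = u := by
    rw [mul_comm, Nat.mul_add_div hN, Nat.div_eq_of_lt v.2, add_zero]
  have d2 : (u * (L * n) + v.val) % (L * n) = v := by
    rw [mul_comm, Nat.mul_add_mod, Nat.mod_eq_of_lt v.2]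
  have lt_of : ∀ {x : ℕ}, x < L * n → x % 2 ^ w = x := fun hx => Nat.mod_eq_of_lt (by omega)
  have e1 : (1 : ℕ) % 2 ^ w = 1 := Nat.mod_eq_of_lt (by omega)
  have e2 : u.val % 2 ^ w = u := lt_of u.2
  have e3 : v.val % 2 ^ w = v := lt_of v.2
  have e4 : (u.val / n) % 2 ^ w = u / n := lt_of ((Nat.div_le_self _ _).trans_lt u.2)
  have e5 : (v.val / n) % 2 ^ w = v / n := lt_of ((Nat.div_le_self _ _).trans_lt v.2)
  have e6 : (u.val % n) % 2 ^ w = u % n := lt_of ((Nat.mod_le _ _).trans_lt u.2)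
  have e7 : (v.val % n) % 2 ^ w = v % n := lt_of ((Nat.mod_le _ _).trans_lt v.2)
  have e8 : (1 + (k * n) * (k * n) + 1) % 2 ^ w = 1 + (k * n) * (k * n) + 1 :=
    Nat.mod_eq_of_lt (by omega)
  have e9 : (1 + (k * n) * (k * n) + 1 + (u * (L * n) + v)) % 2 ^ w =
    1 + (k * n) * (k * n) + 1 + (u * (L * n) + v) := Nat.mod_eq_of_lt (by omega)
  have e10 : (u * (L * n) + v + 1) % 2 ^ w = u * (L * n) + v + 1 :=
    Nat.mod_eq_of_lt (by omega)
  let σ₄ : State := (((σ.setReg 5 (u / n)).setReg 6 (v / n)).setReg 7 (u % n)).setReg 8 (v % n)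
  have r : ∀ x, x < 5 → σ₄.reg x = σ.reg x := by
    intro x hx
    simp only [σ₄, State.setReg, Function.update_apply]
    rw [if_neg (by omega), if_neg (by omega), if_neg (by omega), if_neg (by omega)]
  have h4 : Frame k L n w p (cliqueInput G).mem σ₄ :=
    h.congr (fun x hx => r x (by omega)) fun _ _ => rfl
  have hE : (orList arcExpr E).eval w σ₄ = truth (∃ e ∈ E, e.1 = u.divNat ∧ e.2.1 = v.divNat ∧
      e.2.2.Holds G u.modNat v.modNat) :=
    eval_arcs h4 (by simp [σ₄, State.setReg])
      (by simp [σ₄, State.setReg])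
      (by simp [σ₄, State.setReg])
      (by simp [σ₄, State.setReg]) E
  have run4 : Runs w (.assign 5 (.bin .div (.bin .div (.reg 4) (.reg 2)) (.reg 1))) σ
      (σ.setReg 5 (u / n)) 6 :=
    .assign_of (by simp only [Expr.eval, BinOp.eval, hx, h.reg1, h.reg2, d1, e2, e4]) rfl
  have run5 : Runs w (.assign 6 (.bin .div (.bin .mod (.reg 4) (.reg 2)) (.reg 1)))
      (σ.setReg 5 (u / n)) ((σ.setReg 5 (u / n)).setReg 6 (v / n)) 6 :=
    .assign_of (by simp [State.setReg, Expr.eval, BinOp.eval, hx, h.reg1, h.reg2, d2, e3, e5]) rfl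
  have run6 : Runs w (.assign 7 (.bin .mod (.bin .div (.reg 4) (.reg 2)) (.reg 1)))
      ((σ.setReg 5 (u / n)).setReg 6 (v / n))
      (((σ.setReg 5 (u / n)).setReg 6 (v / n)).setReg 7 (u % n)) 6 :=
    .assign_of (by simp [State.setReg, Expr.eval, BinOp.eval, hx, h.reg1, h.reg2, d1, e2, e6]) rfl
  have run7 : Runs w (.assign 8 (.bin .mod (.bin .mod (.reg 4) (.reg 2)) (.reg 1)))
      (((σ.setReg 5 (u / n)).setReg 6 (v / n)).setReg 7 (u % n)) σ₄ 6 :=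
    .assign_of (by simp [State.setReg, Expr.eval, BinOp.eval, hx, h.reg1, h.reg2, d2, e3, e7]) rfl
  let σ₅ : State := σ₄.setMem (1 + (k * n) * (k * n) + 1 + (u * (L * n) + v))
    (truth (∃ e ∈ E, e.1 = u.divNat ∧ e.2.1 = v.divNat ∧ e.2.2.Holds G u.modNat v.modNat))
  have run8 : Runs w (.store (.bin .add (.bin .add (.reg 0) (.lit 1)) (.reg 4)) (orList arcExpr E))
      σ₄ σ₅ (6 + (orList arcExpr E).cost) :=
    .store_of (by simp only [Expr.eval, BinOp.eval, h4.reg0, r 4 (by omega), hx, e1, e8, e9]) hE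
      (by simp only [Expr.cost]; omega)
  have run9 : Runs w (.assign 4 (.bin .add (.reg 4) (.lit 1))) σ₅
      (σ₅.setReg 4 (u * (L * n) + v + 1)) 4 :=
    .assign_of (by simp only [Expr.eval, BinOp.eval, σ₅, State.setMem, r 4 (by omega), hx, e1,
      e10]) rfl
  refine ⟨σ₅.setReg 4 (u * (L * n) + v + 1), ?_, h4.congr ?_ ?_, ?_, rfl⟩
  · exact (run4.seq (run5.seq (run6.seq (run7.seq (run8.seq run9))))).cast (by omega)
  · intro x hx
    simp only [State.setReg, σ₅, State.setMem, Function.update_apply]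
    rw [if_neg (by omega)]
  · intro x hx
    simp only [State.setReg, σ₅, State.setMem, Function.update_apply]
    rw [if_neg (by omega)]
  · simp [State.setReg]

/-- The vertices of the adjacency matrix entry with number `x`, and back. -/
theorem exists_entry {N x : ℕ} (hx : x < N * N) : ∃ u v : Fin N, x = u * N + v := by
  have hN : 0 < N := Nat.pos_of_ne_zero (by rintro rfl; simp at hx)
  exact ⟨⟨x / N, Nat.div_lt_of_lt_mul hx⟩, ⟨x % N, Nat.mod_lt _ hN⟩,
    by simp only; rw [mul_comm, Nat.div_add_mod]⟩

/-- Induction on the number d of entries still to be written. Each round costs 4 steps for the loop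
test besides the entry itself, and the final failing test costs 4 more. -/
theorem runs_matrixProg {k L n w p : ℕ} {G : SimpleGraph (Fin k × Fin n)}
    (E : List (Fin L × Fin L × ColRel k)) (d : ℕ) (σ : State)
    (h : Frame k L n w p (cliqueInput G).mem σ) (hd : σ.reg 4 + d = (L * n) * (L * n))
    (hm : ∀ u v : Fin (L * n), u * (L * n) + v < σ.reg 4 →
      σ.mem (1 + (k * n) * (k * n) + 1 + (u * (L * n) + v)) =
        truth (∃ e ∈ E, e.1 = u.divNat ∧ e.2.1 = v.divNat ∧
          e.2.2.Holds G u.modNat v.modNat)) :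
    ∃ σ', Runs w (matrixProg E) σ σ' (4 + d * (38 + (orList arcExpr E).cost)) ∧
      Frame k L n w p (cliqueInput G).mem σ' ∧
      ∀ u v : Fin (L * n), σ'.mem (1 + (k * n) * (k * n) + 1 + (u * (L * n) + v)) =
        truth (∃ e ∈ E, e.1 = u.divNat ∧ e.2.1 = v.divNat ∧
          e.2.2.Holds G u.modNat v.modNat) := by
  have hb := h.bound
  have e1 : (1 : ℕ) % 2 ^ w = 1 := Nat.mod_eq_of_lt (by omega)
  induction d generalizing σ with
  | zero =>
    refine ⟨σ, ?_, h, fun u v => hm u v ?_⟩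
    · refine (Runs.loop_false ?_).cast (by simp [Expr.cost])
      simp only [Expr.eval, BinOp.eval, h.reg3]
      rw [if_neg (by omega), Nat.zero_mod]
    · have := mul_add_lt_mul u.2 v.2
      omega
  | succ d ih =>
    obtain ⟨u, v, hx⟩ := exists_entry (N := L * n) (x := σ.reg 4) (by omega)
    obtain ⟨σ₁, run, h₁, hx₁, hm₁⟩ := runs_entryProg h E hx
    obtain ⟨σ₂, run₂, h₂, hm₂⟩ := ih σ₁ h₁ (by omega) (by
      intro u' v' huv
      rw [hm₁, Function.update_apply]
      split_ifs with heq
      · have heq' : u' * (L * n) + v'.val = u * (L * n) + v := Nat.add_left_cancel heq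
        have hd := congrArg (· / (L * n)) heq'
        have hr := congrArg (· % (L * n)) heq'
        have hN : 0 < L * n := Nat.mul_pos h.Lpos h.npos
        simp only [mul_comm _ (L * n), Nat.mul_add_mod, Nat.mul_add_div hN,
          Nat.div_eq_of_lt v.2, Nat.div_eq_of_lt v'.2, Nat.mod_eq_of_lt v.2,
          Nat.mod_eq_of_lt v'.2, add_zero] at hd hr
        rw [Fin.ext hd, Fin.ext hr]
      · exact hm u' v' (by omega))
    refine ⟨σ₂, ?_, h₂, hm₂⟩
    refine (Runs.loop_true ?_ run run₂).cast (by simp only [Expr.cost]; ring)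
    simp only [Expr.eval, BinOp.eval, h.reg3]
    rw [if_pos (by omega)]
    omega

theorem runs_terminalProg {k L n w p : ℕ} {μ : ℕ → ℕ} {σ : State} (h : Frame k L n w p μ σ)
    (f : ℕ → ℕ) (hf : ∀ j, f j < L) (j : ℕ) (hj : j ≤ 2 * p) :
    ∃ σ', Runs w (terminalProg f j) σ σ' (1 + 11 * j) ∧ σ'.reg = σ.reg ∧
      (∀ x < 1 + (k * n) * (k * n) + 1 + (L * n) * (L * n), σ'.mem x = σ.mem x) ∧
      ∀ i < j, σ'.mem (1 + (k * n) * (k * n) + 1 + (L * n) * (L * n) + i) = f i * n := by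
  induction j with
  | zero => exact ⟨σ, .skip σ, rfl, fun _ _ => rfl, fun i hi => by omega⟩
  | succ j ih =>
    obtain ⟨σ₁, run, hr, hm, hv⟩ := ih (by omega)
    have hb := h.bound
    have hL : L * 1 ≤ L * n := Nat.mul_le_mul_left _ h.npos
    have hLL : 1 * (L * n) ≤ (L * n) * (L * n) :=
      Nat.mul_le_mul_right _ (Nat.mul_pos h.Lpos h.npos)
    have hfj := hf j
    have hfn : f j * n ≤ L * n := Nat.mul_le_mul_right _ hfj.le
    have e0 : (f j * n) % 2 ^ w = f j * n := Nat.mod_eq_of_lt (by omega)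
    have e1 : (1 : ℕ) % 2 ^ w = 1 := Nat.mod_eq_of_lt (by omega)
    have e2 : j % 2 ^ w = j := Nat.mod_eq_of_lt (by omega)
    have e3 : f j % 2 ^ w = f j := Nat.mod_eq_of_lt (by omega)
    have e4 : (1 + (k * n) * (k * n) + 1) % 2 ^ w = 1 + (k * n) * (k * n) + 1 :=
      Nat.mod_eq_of_lt (by omega)
    have e5 : (1 + (k * n) * (k * n) + 1 + (L * n) * (L * n)) % 2 ^ w =
      1 + (k * n) * (k * n) + 1 + (L * n) * (L * n) := Nat.mod_eq_of_lt (by omega)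
    have e6 : (1 + (k * n) * (k * n) + 1 + (L * n) * (L * n) + j) % 2 ^ w =
      1 + (k * n) * (k * n) + 1 + (L * n) * (L * n) + j := Nat.mod_eq_of_lt (by omega)
    have run' : Runs w (.store (.bin .add (.bin .add (.bin .add (.reg 0) (.lit 1)) (.reg 3))
        (.lit j)) (.bin .mul (.lit (f j)) (.reg 1))) σ₁
        (σ₁.setMem (1 + (k * n) * (k * n) + 1 + (L * n) * (L * n) + j) (f j * n)) 11 :=
      .store_of (by simp only [Expr.eval, BinOp.eval, hr, h.reg0, h.reg3, e1, e2, e4, e5, e6])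
        (by simp only [Expr.eval, BinOp.eval, hr, h.reg1, e0, e3]) rfl
    refine ⟨_, (run.seq run').cast (by ring), hr, ?_, ?_⟩
    · intro x hx
      simp only [State.setMem, Function.update_apply]
      rw [if_neg (by omega), hm x hx]
    · intro i hi
      simp only [State.setMem, Function.update_apply]
      split_ifs with hij
      · rw [Nat.add_left_cancel hij]
      · exact hv i (by omega)

/-- Every template is expanded by a program. -/
theorem exists_templateProg {k p L : ℕ} (hk : 0 < k) (hL : 0 < L)
    (E : List (Fin L × Fin L × ColRel k)) (s t : Fin p → Fin L) :
    ∃ (prog : Cmd) (c C : ℕ), ∀ (n : ℕ) (hn : 0 < n) (w : ℕ), c * (Nat.log 2 n + 1) ≤ w →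
      ∀ G : SimpleGraph (Fin k × Fin n), ∃ (σ : State) (T : ℕ),
        Runs w prog (cliqueInput G) σ T ∧ T ≤ C * (k * n) ^ 2 ∧
        (templateInstance E s t hn G).StoredAt w σ.mem (σ.reg 0) ∧ L * n ≤ C * (k * n) := by
  -- The rows of the sources followed by those of the targets; the last default is never used.
  let f : ℕ → ℕ := fun j => if h : j < p then (s ⟨j, h⟩ : ℕ) else
    if h : j - p < p then (t ⟨j - p, h⟩ : ℕ) else 0
  have hf : ∀ j, f j < L := by
    intro j
    simp only [f]
    split_ifs
    · exact (s _).2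
    · exact (t _).2
    · exact hL
  -- K * n² bounds the memory in use. Since K ≤ 2 ^ K and n < 2 ^ (log n + 1), words of (K + 2) *
  -- (log n + 1) bits can address it.
  let K := 2 + k * k + L * L + 2 * p
  -- The summand L bounds the number of vertices and the rest the time; 29 = 24 + 4 + 1 counts the
  -- setup, the last loop test and the initial `skip` of the terminals.
  let C := L + (29 + 22 * p + L * L * (38 + (orList arcExpr E).cost))
  refine ⟨.seq (setupProg k L) (.seq (matrixProg E) (terminalProg f (2 * p))), K + 2, C, ?_⟩
  intro n hn w hw G
  have hnn : 1 ≤ n * n := Nat.mul_pos hn hn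
  have hb : 1 + (k * n) * (k * n) + 1 + (L * n) * (L * n) + 2 * p ≤ 2 ^ w := by
    have h1 : n < 2 ^ (Nat.log 2 n + 1) := Nat.lt_pow_succ_log_self (by norm_num) n
    have h2 : 2 ^ 1 ≤ 2 ^ (Nat.log 2 n + 1) := Nat.pow_le_pow_right (by norm_num) (by omega)
    calc 1 + (k * n) * (k * n) + 1 + (L * n) * (L * n) + 2 * p
        ≤ K * (n * n) := by simp only [K]; nlinarith
      _ ≤ 2 ^ K * (n * n) := Nat.mul_le_mul_right _ Nat.lt_two_pow_self.le
      _ ≤ (2 ^ (Nat.log 2 n + 1)) ^ K *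
          (2 ^ (Nat.log 2 n + 1) * 2 ^ (Nat.log 2 n + 1)) :=
        Nat.mul_le_mul (Nat.pow_le_pow_left (by simpa using h2) _) (Nat.mul_le_mul h1.le h1.le)
      _ = 2 ^ ((K + 2) * (Nat.log 2 n + 1)) := by
        rw [← pow_mul, ← pow_add, ← pow_add]
        congr 1
        ring
      _ ≤ 2 ^ w := Nat.pow_le_pow_right (by norm_num) hw
  obtain ⟨σ₁, run₁, h₁, h4⟩ := runs_setupProg hn hL hk hb G
  obtain ⟨σ₂, run₂, h₂, hm₂⟩ := runs_matrixProg E ((L * n) * (L * n)) σ₁ h₁ (by omega)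
    (fun u v h => by omega)
  obtain ⟨σ₃, run₃, hr₃, hm₃, hv₃⟩ := runs_terminalProg h₂ f hf (2 * p) le_rfl
  have hN : (templateInstance E s t hn G).N = L * n := rfl
  refine ⟨σ₃, _, run₁.seq (run₂.seq run₃), ?_, ⟨?_, ?_, ?_, ?_, ?_⟩, ?_⟩
  · have hkk : 1 ≤ k * k := Nat.mul_pos hk hk
    set D := 38 + (orList arcExpr E).cost
    calc 24 + (4 + L * n * (L * n) * D + (1 + 11 * (2 * p)))
        = 29 + 22 * p + (L * L * D) * (n * n) := by ring
      _ ≤ (29 + 22 * p) * (n * n) + (L * L * D) * (n * n) :=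
        Nat.add_le_add_right (Nat.le_mul_of_pos_right _ hnn) _
      _ ≤ C * (n * n) := by
        rw [← add_mul]
        exact Nat.mul_le_mul_right _ (Nat.le_add_left _ _)
      _ ≤ C * ((k * k) * (n * n)) := Nat.mul_le_mul_left _ (Nat.le_mul_of_pos_left _ hkk)
      _ = C * (k * n) ^ 2 := by ring
  · rw [hr₃, h₂.reg0, hN]
    exact hb
  · rw [hr₃, h₂.reg0, hm₃ _ (by omega), h₂.memN]
    rfl
  · intro u v
    have huv : u.val * (L * n) + v.val < (L * n) * (L * n) := mul_add_lt_mul u.2 v.2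
    rw [hr₃, h₂.reg0]
    refine ((hm₃ _ ?_).trans (hm₂ u v)).trans ?_
    · change 1 + (k * n) * (k * n) + 1 + (u.val * (L * n) + v.val) < _
      omega
    · rw [ite_eq_truth]
      rfl
  · intro i
    rw [hr₃, h₂.reg0]
    refine (hv₃ i (by omega)).trans ?_
    simp [f, templateInstance, mul_comm]
  · intro i
    rw [hr₃, h₂.reg0, add_assoc _ p]
    refine (hv₃ (p + i) (by omega)).trans ?_
    simp [f, templateInstance, mul_comm]
  · calc L * n ≤ L * (k * n) := Nat.mul_le_mul_left _ (Nat.le_mul_of_pos_left _ hk)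
      _ ≤ C * (k * n) := Nat.mul_le_mul_right _ (Nat.le_add_right _ _)

end WordRAM

/-! ### Paths in directed graphs -/

section Paths

variable {V W : Type*}

theorem Digraph.IsPathFromTo.map {G : Digraph V} {H : Digraph W} {s t : V} {l : List V}
    (h : G.IsPathFromTo s t l) (f : V → W) (hf : Function.Injective f)
    (hadj : ∀ u v, G.Adj u v → H.Adj (f u) (f v)) : H.IsPathFromTo (f s) (f t) (l.map f) := by
  obtain ⟨h1, h2, h3, h4⟩ := h
  exact ⟨List.isChain_map_of_isChain f hadj h1, h2.map hf, by simp [h3], by simp [h4]⟩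

/-- An isomorphism is needed, not just an embedding: competing paths in `H` are pulled back to `G`.
-/
theorem Digraph.IsShortestPathFromTo.map_equiv {G : Digraph V} {H : Digraph W} {s t : V}
    {l : List V} (h : G.IsShortestPathFromTo s t l) (e : V ≃ W)
    (hadj : ∀ u v, G.Adj u v ↔ H.Adj (e u) (e v)) :
    H.IsShortestPathFromTo (e s) (e t) (l.map e) := by
  refine ⟨h.1.map e e.injective fun u v => (hadj u v).1, fun l' hl' => ?_⟩
  have := h.2 (l'.map e.symm) (by
    simpa using hl'.map e.symm e.symm.injective fun u v huv => (hadj _ _).2 (by simpa using huv))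
  simpa using this

theorem InternallyDisjoint.map {ι : Type*} {P : ι → List V} (h : InternallyDisjoint P) (f : V → W)
    (hf : Function.Injective f) : InternallyDisjoint fun i => (P i).map f := by
  intro i j hij v hv hv'
  rw [← List.map_tail, ← List.map_dropLast] at hv
  obtain ⟨x, hx, rfl⟩ := List.mem_map.1 hv
  exact h i j hij x hx ((List.mem_map_of_injective hf).1 hv')

/-- An invariant that holds at the start of a path and is preserved by arcs holds on the path. -/
theorem Digraph.IsPathFromTo.induct {G : Digraph V} {s t : V} {l : List V}
    (h : G.IsPathFromTo s t l) (p : V → Prop) (hs : p s)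
    (step : ∀ u ∈ l, ∀ v ∈ l, G.Adj u v → p u → p v) : p t := by
  obtain ⟨h1, -, h3, h4⟩ := h
  -- The induction runs over chains l' inside the fixed list l, so that `step` can keep referring to
  -- membership in l.
  suffices ∀ l' : List V, (∀ x ∈ l', x ∈ l) → l'.IsChain G.Adj → ∀ a, l'.head? = some a → p a →
      ∀ x ∈ l', p x from this l (fun _ => id) h1 s h3 hs t (List.mem_of_getLast? h4)
  intro l'
  induction l' with
  | nil => simp
  | cons a l' ih =>
    intro hsub hc b hb hpb x hx
    obtain rfl : a = b := by simpa using hb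
    rcases List.mem_cons.1 hx with rfl | hx
    · exact hpb
    · cases l' with
      | nil => simp at hx
      | cons c l' =>
        rw [List.isChain_cons_cons] at hc
        exact ih (fun y hy => hsub y (List.mem_cons_of_mem _ hy)) hc.2 c rfl
          (step a (hsub a (by simp)) c (hsub c (by simp)) hc.1 hpb) x hx

/-- The vertices of a path other than the end vertices are internal. -/
theorem Digraph.IsPathFromTo.mem_internal {G : Digraph V} {s t v : V} {l : List V}
    (h : G.IsPathFromTo s t l) (hv : v ∈ l) (hs : v ≠ s) (ht : v ≠ t) :
    v ∈ l.tail.dropLast := by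
  obtain ⟨-, -, h3, h4⟩ := h
  obtain ⟨l, rfl⟩ : ∃ l', l = s :: l' := by
    cases l with
    | nil => simp at h3
    | cons a l => exact ⟨l, by simpa using h3⟩
  have hv : v ∈ l := by simpa [hs] using hv
  have hne : l ≠ [] := List.ne_nil_of_mem hv
  have ht' : l.getLast hne = t := by
    rw [List.getLast?_cons_of_ne_nil hne, List.getLast?_eq_getLast_of_ne_nil hne] at h4
    simpa using h4
  rw [← List.dropLast_append_getLast hne, ht', List.mem_append] at hv
  simpa [ht] using hv

/-- A path along which a potential increases by one with every arc is a shortest path if no arc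
increases the potential by more. -/
theorem Digraph.isShortestPathFromTo_of_potential (G : Digraph V) (φ : V → ℕ)
    (hφ : ∀ u v, G.Adj u v → φ v ≤ φ u + 1) (M : ℕ) (h : ℕ → V)
    (hadj : ∀ j < M, G.Adj (h j) (h (j + 1))) (hval : ∀ j ≤ M, φ (h j) = j) :
    G.IsShortestPathFromTo (h 0) (h M) ((List.range (M + 1)).map h) := by
  refine ⟨⟨?_, ?_, ?_, ?_⟩, ?_⟩
  · rw [List.isChain_iff_getElem]
    intro i hi
    simp only [List.length_map, List.length_range] at hi
    simpa using hadj i (by omega)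
  · refine List.Nodup.map_on ?_ List.nodup_range
    intro x hx y hy hxy
    rw [List.mem_range] at hx hy
    rw [← hval x (by omega), hxy, hval y (by omega)]
  · simp [List.range_succ_eq_map]
  · simp [List.range_succ]
  · rintro l ⟨h1, -, h3, h4⟩
    -- Telescoping: on any walk the potential rises by at most the number of edges.
    have key : ∀ l : List V, l.IsChain G.Adj → ∀ a b, l.head? = some a → l.getLast? = some b →
        φ b + 1 ≤ φ a + l.length := by
      intro l
      induction l with
      | nil => simp
      | cons x l ih =>
        intro hc a b ha hb
        obtain rfl : x = a := by simpa using ha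
        cases l with
        | nil =>
          obtain rfl : x = b := by simpa using hb
          simp
        | cons y l =>
          rw [List.isChain_cons_cons] at hc
          have := ih hc.2 y b rfl (by simpa using hb)
          have := hφ x y hc.1
          simp only [List.length_cons] at *
          omega
    have := key l h1 _ _ h3 h4
    rw [hval 0 (by omega), hval M le_rfl] at this
    simpa using by omega

theorem Digraph.IsDAG.of_rank {α : Type*} [Preorder α] (G : Digraph V) (r : V → α)
    (h : ∀ u v, G.Adj u v → r u < r v) : G.IsDAG := by
  intro v hv
  have : ∀ u w, Relation.TransGen G.Adj u w → r u < r w := by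
    intro u w huw
    induction huw with
    | single h' => exact h _ _ h'
    | tail _ h' ih => exact ih.trans (h _ _ h')
  exact lt_irrefl _ (this v v hv)

end Paths

/-! ### The rows of the template -/

/-- The rows of the template: the terminals of the `k` selector paths and of the `m` check paths,
and, for each part `i` and each check path `l`, two rows `inn` and `out` that are crossed by the
check path `l` in the column of the selected vertex of the part `i`, a row `mid` that the selector
path uses in this column, and two rows `cin` and `cout` in which the check path carries a vertex of
an earlier part past the part `i`. -/
inductive Row (k m : ℕ) : Type
  | s (x : Fin k ⊕ Fin m)
  | t (x : Fin k ⊕ Fin m)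
  | inn (i : Fin k) (l : Fin m)
  | out (i : Fin k) (l : Fin m)
  | mid (i : Fin k) (l : Fin m)
  | cin (i : Fin k) (l : Fin m)
  | cout (i : Fin k) (l : Fin m)

instance (k m : ℕ) : Finite (Row k m) := by
  let f : (Fin 2 × (Fin k ⊕ Fin m)) ⊕ (Fin 5 × Fin k × Fin m) → Row k m
    | .inl (0, x) => .s x
    | .inl (1, x) => .t x
    | .inr (0, i, l) => .inn i l
    | .inr (1, i, l) => .out i l
    | .inr (2, i, l) => .mid i l
    | .inr (3, i, l) => .cin i l
    | .inr (4, i, l) => .cout i l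
  refine Finite.of_surjective f fun x => ?_
  cases x with
  | s x => exact ⟨.inl (0, x), rfl⟩
  | t x => exact ⟨.inl (1, x), rfl⟩
  | inn i l => exact ⟨.inr (0, i, l), rfl⟩
  | out i l => exact ⟨.inr (1, i, l), rfl⟩
  | mid i l => exact ⟨.inr (2, i, l), rfl⟩
  | cin i l => exact ⟨.inr (3, i, l), rfl⟩
  | cout i l => exact ⟨.inr (4, i, l), rfl⟩

instance (k : ℕ) : Finite (ColRel k) := by
  let f : Fin 5 ⊕ (Fin k × Fin k) → ColRel k
    | .inl 0 => .all
    | .inl 1 => .same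
    | .inl 2 => .succ
    | .inl 3 => .fst
    | .inl 4 => .lst
    | .inr (i, j) => .adj i j
  refine Finite.of_surjective f fun x => ?_
  cases x with
  | all => exact ⟨.inl 0, rfl⟩
  | same => exact ⟨.inl 1, rfl⟩
  | succ => exact ⟨.inl 2, rfl⟩
  | fst => exact ⟨.inl 3, rfl⟩
  | lst => exact ⟨.inl 4, rfl⟩
  | adj i j => exact ⟨.inr (i, j), rfl⟩

/-- The arcs of the template. The check path `l`, when it is at the part `i`, carries a vertex of
the part `src l i`, and it checks a new vertex of the part `i` if `src l i = i`. -/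
inductive Arc {k m : ℕ} (src : Fin m → Fin k → Fin k) : Row k m → Row k m → ColRel k → Prop
  | s_inn (i l) : l.val = 0 → Arc src (.s (.inl i)) (.inn i l) .fst
  | s_mid (i l) : l.val = 0 → Arc src (.s (.inl i)) (.mid i l) .fst
  | inn_same (i l l') : l'.val = l.val + 1 → Arc src (.inn i l) (.inn i l') .same
  | inn_succ (i l l') : l.val + 1 = m → l'.val = 0 → Arc src (.inn i l) (.inn i l') .succ
  | inn_mid (i l l') : l.val + 1 = m → l'.val = 0 → Arc src (.inn i l) (.mid i l') .succ
  | mid_same (i l l') : l'.val = l.val + 1 → Arc src (.mid i l) (.mid i l') .same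
  | mid_out (i l l') : l.val + 1 = m → l'.val = 0 → Arc src (.mid i l) (.out i l') .succ
  | out_same (i l l') : l'.val = l.val + 1 → Arc src (.out i l) (.out i l') .same
  | out_succ (i l l') : l.val + 1 = m → l'.val = 0 → Arc src (.out i l) (.out i l') .succ
  | inn_out (i l) : Arc src (.inn i l) (.out i l) .same
  | mid_t (i l) : l.val + 1 = m → Arc src (.mid i l) (.t (.inl i)) .lst
  | out_t (i l) : l.val + 1 = m → Arc src (.out i l) (.t (.inl i)) .lst
  | s_check (i l) : i.val = 0 → Arc src (.s (.inr l)) (.inn i l) .all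
  | cin_cout (i l) : Arc src (.cin i l) (.cout i l) .same
  | out_inn (i j l) : j.val = i.val + 1 → src l i = i → src l j = j →
      Arc src (.out i l) (.inn j l) (.adj i j)
  | cout_inn (i j l) : j.val = i.val + 1 → src l j = j →
      Arc src (.cout i l) (.inn j l) (.adj (src l i) j)
  | out_cin (i j l) : j.val = i.val + 1 → src l i = i → src l j = src l i → src l j ≠ j →
      Arc src (.out i l) (.cin j l) .same
  | cout_cin (i j l) : j.val = i.val + 1 → src l j = src l i → src l j ≠ j →
      Arc src (.cout i l) (.cin j l) .same
  | out_end (i l) : i.val + 1 = k → src l i = i → Arc src (.out i l) (.t (.inr l)) .all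
  | cout_end (i l) : i.val + 1 = k → Arc src (.cout i l) (.t (.inr l)) .all

/-- The expanded template. -/
def gadget {k m n : ℕ} (src : Fin m → Fin k → Fin k) (G : SimpleGraph (Fin k × Fin n)) :
    Digraph (Row k m × Fin n) where
  Adj u v := ∃ R, Arc src u.1 v.1 R ∧ R.Holds G u.2 v.2

/-- The rank of a vertex in a topological order, compared lexicographically. -/
def gadgetRank {k m n : ℕ} : Row k m × Fin n → ℕ ×ₗ ℕ ×ₗ ℕ
  | (.s _, _) => toLex (0, toLex (0, 0))
  | (.t _, _) => toLex (3 * k + 3, toLex (0, 0))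
  | (.inn i l, c) => toLex (3 * i + 1, toLex (c, l))
  | (.mid i l, c) => toLex (3 * i + 2, toLex (c, l))
  | (.out i l, c) => toLex (3 * i + 3, toLex (c, l))
  | (.cin i l, c) => toLex (3 * i + 1, toLex (c, l))
  | (.cout i l, c) => toLex (3 * i + 2, toLex (c, l))

theorem gadget_isDAG {k m n : ℕ} (src : Fin m → Fin k → Fin k) (G : SimpleGraph (Fin k × Fin n)) :
    (gadget src G).IsDAG := by
  refine .of_rank _ gadgetRank ?_
  rintro ⟨u, c⟩ ⟨v, c'⟩ ⟨R, h, hR⟩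
  cases h <;> simp only [gadgetRank, ColRel.Holds, Prod.Lex.toLex_lt_toLex] at * <;> grind

/-! ### Soundness: disjoint paths force a clique -/

section Soundness

variable {k m n : ℕ} (src : Fin m → Fin k → Fin k) (G : SimpleGraph (Fin k × Fin n))

/-- What a selector path of the part `i₀` with the vertices `S` has done when it reaches a vertex:
it has used the rows `inn` up to some column and the rows `out` from some column on, which leaves at
most one column free. -/
def SelectorInv (S : List (Row k m × Fin n)) (i₀ : Fin k) : Row k m × Fin n → Prop
  | (.s x, _) => x = .inl i₀
  | (.inn i l, c) => i₀ < i ∨ i = i₀ ∧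
      ∀ c' l', (c' < c ∨ c' = c ∧ l' ≤ l) → (.inn i₀ l', c') ∈ S
  | (.mid i _, c) => i₀ < i ∨ i = i₀ ∧ ∀ c' l', c' < c → (.inn i₀ l', c') ∈ S
  | (.out i l, c) => i₀ < i ∨ i = i₀ ∧ ∃ a, (∀ c' l', c' < a → (.inn i₀ l', c') ∈ S) ∧
      ∀ c' l', a < c' → (c' < c ∨ c' = c ∧ l' ≤ l) → (.out i₀ l', c') ∈ S
  | (.t (.inl i), _) => i₀ < i ∨ i = i₀ ∧ ∃ a : Fin n, ∀ c' l',
      (c' < a → (.inn i₀ l', c') ∈ S) ∧ (a < c' → (.out i₀ l', c') ∈ S)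
  | (.t (.inr _), _) => True
  | (.cin i _, _) => i₀ < i
  | (.cout i _, _) => i₀ < i

/-- Every selector path leaves at most one column free. -/
theorem exists_selected {S : List (Row k m × Fin n)} {i : Fin k} {z z' : Fin n}
    (h : (gadget src G).IsPathFromTo (.s (.inl i), z) (.t (.inl i), z') S) :
    ∃ a : Fin n, ∀ c l, (c < a → (.inn i l, c) ∈ S) ∧ (a < c → (.out i l, c) ∈ S) := by
  have := h.induct (SelectorInv S i) rfl (by
    rintro ⟨u, c⟩ - ⟨v, c'⟩ hv ⟨R, huv, hR⟩ hu
    cases huv with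
    | s_inn j l hl =>
      obtain rfl : j = i := by simpa [SelectorInv] using hu
      refine .inr ⟨rfl, fun d l' hd => ?_⟩
      simp only [ColRel.Holds] at hR
      have h1 : d = c' := by grind
      have h2 : l' = l := by grind
      rwa [h1, h2]
    | s_mid j l hl =>
      obtain rfl : j = i := by simpa [SelectorInv] using hu
      refine .inr ⟨rfl, fun d l' hd => ?_⟩
      simp only [ColRel.Holds] at hR
      grind
    | inn_same j l l' hl =>
      rcases hu with hu | ⟨rfl, hu⟩
      · exact .inl hu
      · refine .inr ⟨rfl, fun d e hd => ?_⟩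
        simp only [ColRel.Holds] at hR
        by_cases he : d = c' ∧ e = l'
        · rwa [he.1, he.2]
        · exact hu d e (by grind)
    | inn_succ j l l' hl hl' =>
      rcases hu with hu | ⟨rfl, hu⟩
      · exact .inl hu
      · refine .inr ⟨rfl, fun d e hd => ?_⟩
        simp only [ColRel.Holds] at hR
        by_cases he : d = c' ∧ e = l'
        · rwa [he.1, he.2]
        · exact hu d e (by grind)
    | inn_mid j l l' hl hl' =>
      rcases hu with hu | ⟨rfl, hu⟩
      · exact .inl hu
      · refine .inr ⟨rfl, fun d e hd => ?_⟩
        simp only [ColRel.Holds] at hR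
        exact hu d e (by grind)
    | mid_same j l l' hl =>
      rcases hu with hu | ⟨rfl, hu⟩
      · exact .inl hu
      · refine .inr ⟨rfl, fun d e hd => ?_⟩
        simp only [ColRel.Holds] at hR
        exact hu d e (by grind)
    | mid_out j l l' hl hl' =>
      rcases hu with hu | ⟨rfl, hu⟩
      · exact .inl hu
      · refine .inr ⟨rfl, c, hu, fun d e hd hd' => ?_⟩
        simp only [ColRel.Holds] at hR
        have h1 : d = c' := by grind
        have h2 : e = l' := by grind
        rwa [h1, h2]
    | out_same j l l' hl =>
      rcases hu with hu | ⟨rfl, a, hu, hu'⟩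
      · exact .inl hu
      · refine .inr ⟨rfl, a, hu, fun d e hd hd' => ?_⟩
        simp only [ColRel.Holds] at hR
        by_cases he : d = c' ∧ e = l'
        · rwa [he.1, he.2]
        · exact hu' d e hd (by grind)
    | out_succ j l l' hl hl' =>
      rcases hu with hu | ⟨rfl, a, hu, hu'⟩
      · exact .inl hu
      · refine .inr ⟨rfl, a, hu, fun d e hd hd' => ?_⟩
        simp only [ColRel.Holds] at hR
        by_cases he : d = c' ∧ e = l'
        · rwa [he.1, he.2]
        · exact hu' d e hd (by grind)
    | inn_out j l =>
      rcases hu with hu | ⟨rfl, hu⟩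
      · exact .inl hu
      · simp only [ColRel.Holds] at hR
        -- Switching from `inn` to `out` within column c also leaves at most c free; the clause on
        -- `out` is still vacuous here.
        exact .inr ⟨rfl, c, fun d e hd => hu d e (.inl hd), fun d e hd hd' => by grind⟩
    | mid_t j l hl =>
      rcases hu with hu | ⟨rfl, hu⟩
      · exact .inl hu
      · simp only [ColRel.Holds] at hR
        exact .inr ⟨rfl, c, fun d e => ⟨hu d e, fun hd => by grind⟩⟩
    | out_t j l hl =>
      rcases hu with hu | ⟨rfl, a, hu, hu'⟩
      · exact .inl hu
      · simp only [ColRel.Holds] at hR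
        exact .inr ⟨rfl, a, fun d e => ⟨hu d e, fun hd => hu' d e hd (by grind)⟩⟩
    | s_check j l hj => simp [SelectorInv] at hu
    | cin_cout j l => exact hu
    -- The arcs to a later part. No arc leads back to an earlier part, so a path that leaves part i
    -- this way cannot end at the target of its selector path.
    | out_inn j j' l hj =>
      have : i ≤ j := by rcases hu with hu | ⟨rfl, -⟩ <;> omega
      exact .inl (by omega)
    | cout_inn j j' l hj =>
      have : i < j := hu
      exact .inl (by omega)
    | out_cin j j' l hj =>
      have : i ≤ j := by rcases hu with hu | ⟨rfl, -⟩ <;> omega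
      exact (by omega : i < j')
    | cout_cin j j' l hj =>
      have : i < j := hu
      exact (by omega : i < j')
    | out_end j l hj => trivial
    | cout_end j l hj => trivial)
  rcases this with h | ⟨-, h⟩
  · exact absurd h (lt_irrefl _)
  · exact h

/-- The check path `l` has made its checks up to the part `i`. -/
def Checked (a : Fin k → Fin n) (l : Fin m) (i : Fin k) : Prop :=
  ∀ j' j : Fin k, j'.val + 1 = j.val → j ≤ i → src l j = j →
    G.Adj (src l j', a (src l j')) (j, a j)

/-- What a path from the source of the check path `l₀` has done when it reaches a vertex, if the
vertex `a i` is selected in the part `i`. -/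
def CheckInv (a : Fin k → Fin n) (l₀ : Fin m) : Row k m × Fin n → Prop
  | (.s x, _) => x = .inr l₀
  | (.inn i l, c) => a i < c ∨ c = a i ∧ l₀ ≤ l ∧ (l = l₀ → Checked src G a l₀ i)
  | (.mid i _, c) => a i < c
  | (.out i l, c) => c = a i ∧ l₀ ≤ l ∧ (l = l₀ → Checked src G a l₀ i)
  | (.t (.inl _), _) => True
  | (.t (.inr l), _) => l₀ ≤ l ∧ (l = l₀ → ∀ i, Checked src G a l₀ i)
  | (.cin i l, c) => c = a (src l i) ∧ l₀ ≤ l ∧ (l = l₀ → Checked src G a l₀ i)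
  | (.cout i l, c) => c = a (src l i) ∧ l₀ ≤ l ∧ (l = l₀ → Checked src G a l₀ i)

/-- Entering part j adds only the check between j and its predecessor i. -/
theorem checked_step {a : Fin k → Fin n} {l : Fin m} {i j : Fin k} (hij : j.val = i.val + 1)
    (h : Checked src G a l i) (hj : src l j = j → G.Adj (src l i, a (src l i)) (j, a j)) :
    Checked src G a l j := by
  intro t' t ht htj hsrc
  rcases htj.lt_or_eq with hlt | rfl
  · exact h t' t ht (by omega) hsrc
  · obtain rfl : t' = i := by omega
    exact hj hsrc

/-- A check path that avoids the selector paths makes all its checks. -/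
theorem checked_of_path {a : Fin k → Fin n} {l₀ : Fin m} {z z' : Fin n}
    {S : List (Row k m × Fin n)}
    (h : (gadget src G).IsPathFromTo (.s (.inr l₀), z) (.t (.inr l₀), z') S)
    (hinn : ∀ i l c, (.inn i l, c) ∈ S → a i ≤ c) (hout : ∀ i l c, (.out i l, c) ∈ S → c ≤ a i)
    (i : Fin k) : Checked src G a l₀ i := by
  have := h.induct (CheckInv src G a l₀) rfl (by
    rintro ⟨u, c⟩ - ⟨v, c'⟩ hv ⟨R, huv, hR⟩ hu
    cases huv with
    | s_inn j l hl => simp [CheckInv] at hu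
    | s_mid j l hl => simp [CheckInv] at hu
    | inn_same j l l' hl =>
      simp only [ColRel.Holds] at hR
      subst hR
      rcases hu with hu | ⟨rfl, hu, -⟩
      · exact .inl hu
      -- The level has risen strictly above l₀, so the claim about level l₀ is vacuous.
      · exact .inr ⟨rfl, by omega, fun _ => by omega⟩
    | inn_succ j l l' hl hl' =>
      simp only [ColRel.Holds] at hR
      have : a j ≤ c := by rcases hu with hu | ⟨rfl, -⟩ <;> omega
      exact .inl (by omega)
    | inn_mid j l l' hl hl' =>
      simp only [ColRel.Holds] at hR
      have : a j ≤ c := by rcases hu with hu | ⟨rfl, -⟩ <;> omega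
      exact (by omega : a j < c')
    | mid_same j l l' hl =>
      simp only [ColRel.Holds] at hR
      exact hR ▸ hu
    -- Behind the selected column every `out` vertex is taken by the selector path, so this arc
    -- cannot be used.
    | mid_out j l l' hl hl' =>
      simp only [ColRel.Holds] at hR
      have h1 : a j < c := hu
      have h2 := hout _ _ _ hv
      omega
    | out_same j l l' hl =>
      simp only [ColRel.Holds] at hR
      subst hR
      obtain ⟨rfl, hu, -⟩ := hu
      exact ⟨rfl, by omega, fun _ => by omega⟩
    | out_succ j l l' hl hl' =>
      simp only [ColRel.Holds] at hR
      obtain ⟨rfl, -⟩ := hu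
      have h2 := hout _ _ _ hv
      omega
    | inn_out j l =>
      simp only [ColRel.Holds] at hR
      subst hR
      have h2 := hout _ _ _ hv
      rcases hu with hu | hu
      · omega
      · exact hu
    | mid_t j l hl => trivial
    | out_t j l hl => trivial
    | s_check j l hj =>
      obtain rfl : l = l₀ := by simpa [CheckInv] using hu
      rcases (hinn _ _ _ hv).lt_or_eq with hlt | heq
      · exact .inl hlt
      · exact .inr ⟨heq.symm, le_rfl, fun _ t' t ht htj => by omega⟩
    | cin_cout j l =>
      simp only [ColRel.Holds] at hR
      exact hR ▸ hu
    | out_inn j j' l hj hs hs' =>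
      simp only [ColRel.Holds] at hR
      obtain ⟨rfl, hle, hu⟩ := hu
      rcases (hinn _ _ _ hv).lt_or_eq with hlt | heq
      · exact .inl hlt
      · refine .inr ⟨heq.symm, hle, ?_⟩
        rintro rfl
        exact checked_step src G hj (hu rfl) fun _ => by rw [hs, heq]; exact hR
    | cout_inn j j' l hj hs' =>
      simp only [ColRel.Holds] at hR
      obtain ⟨rfl, hle, hu⟩ := hu
      rcases (hinn _ _ _ hv).lt_or_eq with hlt | heq
      · exact .inl hlt
      · refine .inr ⟨heq.symm, hle, ?_⟩
        rintro rfl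
        exact checked_step src G hj (hu rfl) fun _ => by rw [heq]; exact hR
    | out_cin j j' l hj hs hs' hne =>
      simp only [ColRel.Holds] at hR
      subst hR
      obtain ⟨rfl, hle, hu⟩ := hu
      refine ⟨by rw [hs', hs], hle, ?_⟩
      rintro rfl
      exact checked_step src G hj (hu rfl) fun h => absurd h hne
    | cout_cin j j' l hj hs' hne =>
      simp only [ColRel.Holds] at hR
      subst hR
      obtain ⟨rfl, hle, hu⟩ := hu
      refine ⟨by rw [hs'], hle, ?_⟩
      rintro rfl
      exact checked_step src G hj (hu rfl) fun h => absurd h hne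
    | out_end j l hj hs =>
      obtain ⟨-, hle, hu⟩ := hu
      exact ⟨hle, fun hl i t' t ht hti => hu hl t' t ht (by omega)⟩
    | cout_end j l hj =>
      obtain ⟨-, hle, hu⟩ := hu
      exact ⟨hle, fun hl i t' t ht hti => hu hl t' t ht (by omega)⟩)
  exact this.2 rfl i

/-- Internally disjoint paths in the gadget yield a clique. -/
theorem exists_clique_of_paths
    (hsrc : ∀ i j : Fin k, i < j → ∃ l, ∃ j' : Fin k, j'.val + 1 = j ∧ src l j' = i ∧ src l j = j)
    {z : Fin n} {P : Fin k ⊕ Fin m → List (Row k m × Fin n)}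
    (hP : ∀ x, (gadget src G).IsPathFromTo (.s x, z) (.t x, z) (P x))
    (hdis : InternallyDisjoint P) :
    ∃ a : Fin k → Fin n, ∀ i j, i < j → G.Adj (i, a i) (j, a j) := by
  choose a ha using fun i => exists_selected src G (hP (.inl i))
  refine ⟨a, fun i j hij => ?_⟩
  obtain ⟨l, j', hj', hi, hj⟩ := hsrc i j hij
  -- Vertices in the rows `inn` and `out` are not terminals, hence internal on the check path, and
  -- disjointness keeps them off the selector paths.
  have := checked_of_path src G (hP (.inr l)) (a := a)
    (fun i l' c hc => not_lt.1 fun hlt => hdis (.inr l) (.inl i) (by simp) _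
      ((hP _).mem_internal hc (by simp) (by simp)) ((ha i c l').1 hlt))
    (fun i l' c hc => not_lt.1 fun hlt => hdis (.inr l) (.inl i) (by simp) _
      ((hP _).mem_internal hc (by simp) (by simp)) ((ha i c l').2 hlt))
    j j' j hj' le_rfl hj
  rwa [hi] at this

end Soundness

/-! ### Completeness: a clique yields disjoint shortest paths -/

section Completeness

variable {k m n : ℕ} (src : Fin m → Fin k → Fin k) (G : SimpleGraph (Fin k × Fin n))

/-- The row used by a selector path in the column `c` if the column `a` is selected. -/
def selectorRow (i : Fin k) (a c : Fin n) (l : Fin m) : Row k m :=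
  if c < a then .inn i l else if c = a then .mid i l else .out i l

/-- The selector path of the part `i` if the column `a` is selected. -/
def selectorVertex (z a : Fin n) (i : Fin k) (x : ℕ) : Row k m × Fin n :=
  if x = 0 then (.s (.inl i), z)
  else if h : x - 1 < n * m then
    (selectorRow i a (Fin.divNat ⟨x - 1, h⟩) (Fin.modNat ⟨x - 1, h⟩), Fin.divNat ⟨x - 1, h⟩)
  else (.t (.inl i), z)

/-- The row used by the check path `l` in the first or the second step at the part `i`. -/
def checkRow (l : Fin m) (i : Fin k) (b : Fin 2) : Row k m :=
  if src l i = i then (if b = 0 then .inn i l else .out i l)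
  else (if b = 0 then .cin i l else .cout i l)

/-- The check path `l` if the columns `a i` are selected. -/
def checkVertex (z : Fin n) (a : Fin k → Fin n) (l : Fin m) (x : ℕ) : Row k m × Fin n :=
  if x = 0 then (.s (.inr l), z)
  else if h : x - 1 < k * 2 then
    (checkRow src l (Fin.divNat ⟨x - 1, h⟩) (Fin.modNat ⟨x - 1, h⟩),
      a (src l (Fin.divNat ⟨x - 1, h⟩)))
  else (.t (.inr l), z)

theorem checkRow_zero (l : Fin m) (i : Fin k) :
    checkRow src l i 0 = if src l i = i then .inn i l else .cin i l := by simp [checkRow]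

theorem checkRow_one (l : Fin m) (i : Fin k) :
    checkRow src l i 1 = if src l i = i then .out i l else .cout i l := by simp [checkRow]

theorem divNat_modNat_mk {a b : ℕ} (c : Fin a) (d : Fin b) (h : c.val * b + d.val < a * b) :
    Fin.divNat (⟨c * b + d, h⟩ : Fin (a * b)) = c ∧
      Fin.modNat (⟨c * b + d, h⟩ : Fin (a * b)) = d := by
  constructor
  · ext
    simp only [Fin.coe_divNat]
    rw [mul_comm, Nat.mul_add_div d.pos, Nat.div_eq_of_lt d.2, add_zero]
  · ext
    simp only [Fin.coe_modNat]
    rw [mul_comm, Nat.mul_add_mod, Nat.mod_eq_of_lt d.2]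

theorem exists_mul_add {a b x : ℕ} (hx : x < a * b) :
    ∃ (c : Fin a) (d : Fin b), x = c.val * b + d.val := by
  have hb : 0 < b := Nat.pos_of_ne_zero (by rintro rfl; simp at hx)
  exact ⟨⟨x / b, Nat.div_lt_of_lt_mul (by rwa [mul_comm])⟩, ⟨x % b, Nat.mod_lt _ hb⟩,
    by simp only; rw [mul_comm, Nat.div_add_mod]⟩

theorem selectorVertex_zero (z a : Fin n) (i : Fin k) :
    selectorVertex (m := m) z a i 0 = (.s (.inl i), z) := by simp [selectorVertex]

theorem selectorVertex_end (z a : Fin n) (i : Fin k) :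
    selectorVertex (m := m) z a i (n * m + 1) = (.t (.inl i), z) := by simp [selectorVertex]

theorem selectorVertex_succ (z a : Fin n) (i : Fin k) (c : Fin n) (l : Fin m) :
    selectorVertex z a i (c * m + l + 1) = (selectorRow i a c l, c) := by
  have h := WordRAM.mul_add_lt_mul c.2 l.2
  simp [selectorVertex, h, divNat_modNat_mk]

theorem checkVertex_zero (z : Fin n) (a : Fin k → Fin n) (l : Fin m) :
    checkVertex src z a l 0 = (.s (.inr l), z) := by simp [checkVertex]

theorem checkVertex_end (z : Fin n) (a : Fin k → Fin n) (l : Fin m) :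
    checkVertex src z a l (k * 2 + 1) = (.t (.inr l), z) := by simp [checkVertex]

theorem checkVertex_succ (z : Fin n) (a : Fin k → Fin n) (l : Fin m) (i : Fin k) (b : Fin 2) :
    checkVertex src z a l (i * 2 + b + 1) = (checkRow src l i b, a (src l i)) := by
  have h := WordRAM.mul_add_lt_mul i.2 b.2
  simp [checkVertex, h, divNat_modNat_mk]

/-- The path that contains a vertex if the columns `a i` are selected. -/
def owner (a : Fin k → Fin n) : Row k m × Fin n → Fin k ⊕ Fin m
  | (.s x, _) => x
  | (.t x, _) => x
  | (.inn i l, c) => if c = a i then .inr l else .inl i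
  | (.out i l, c) => if c = a i then .inr l else .inl i
  | (.mid i _, _) => .inl i
  | (.cin _ l, _) => .inr l
  | (.cout _ l, _) => .inr l

theorem owner_selectorVertex (z : Fin n) (a : Fin k → Fin n) (i : Fin k) (x : ℕ) :
    owner (m := m) a (selectorVertex z (a i) i x) = .inl i := by
  unfold selectorVertex selectorRow
  split_ifs <;> simp only [owner] <;> grind

theorem owner_checkVertex (z : Fin n) (a : Fin k → Fin n) (l : Fin m) (x : ℕ) :
    owner a (checkVertex src z a l x) = .inr l := by
  unfold checkVertex checkRow
  split_ifs <;> simp only [owner] <;> grind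

/-- The distance from the source of the selector path of the part `i₀`, as far as it matters. -/
def selectorPotential (i₀ : Fin k) : Row k m × Fin n → ℕ
  | (.s x, _) => if x = .inl i₀ then 0 else n * m + 1
  | (.t x, _) => if x = .inl i₀ then n * m + 1 else 0
  | (.inn i l, c) => if i < i₀ then n * m + 1 else if i = i₀ then c * m + l + 1 else 0
  | (.mid i l, c) => if i < i₀ then n * m + 1 else if i = i₀ then c * m + l + 1 else 0
  | (.out i l, c) => if i < i₀ then n * m + 1 else if i = i₀ then c * m + l + 1 else 0
  | (.cin i _, _) => if i < i₀ then n * m + 1 else 0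
  | (.cout i _, _) => if i < i₀ then n * m + 1 else 0

/-- The distance from the sources of the check paths, as far as it matters. -/
def checkPotential : Row k m × Fin n → ℕ
  | (.s (.inl i), _) => 2 * i + 1
  | (.s (.inr _), _) => 0
  | (.t (.inl _), _) => 0
  | (.t (.inr _), _) => 2 * k + 1
  | (.inn i _, _) => 2 * i + 1
  | (.mid i _, _) => 2 * i + 1
  | (.out i _, _) => 2 * i + 2
  | (.cin i _, _) => 2 * i + 1
  | (.cout i _, _) => 2 * i + 2

theorem checkPotential_le (u v : Row k m × Fin n) (h : (gadget src G).Adj u v) :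
    checkPotential v ≤ checkPotential u + 1 := by
  obtain ⟨u, c⟩ := u
  obtain ⟨v, c'⟩ := v
  obtain ⟨R, h, -⟩ := h
  cases h <;> simp only [checkPotential] at * <;> omega

/-- Earlier parts have the maximal value and later parts the value 0, so arcs between different
parts cause no rise. Inside part i₀ an arc keeps the position c * m + l or advances it by one,
`succ` leading from level m - 1 to level 0 of the next column. -/
theorem selectorPotential_le (i₀ : Fin k) (u v : Row k m × Fin n) (h : (gadget src G).Adj u v) :
    selectorPotential i₀ v ≤ selectorPotential i₀ u + 1 := by
  obtain ⟨u, c⟩ := u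
  obtain ⟨v, c'⟩ := v
  obtain ⟨R, h, hR⟩ := h
  have hc : ∀ l : Fin m, c.val * m + l.val < n * m := fun l => WordRAM.mul_add_lt_mul c.2 l.2
  have hc' : ∀ l : Fin m, c'.val * m + l.val < n * m := fun l => WordRAM.mul_add_lt_mul c'.2 l.2
  have hs : c.val + 1 = c'.val → c'.val * m = c.val * m + m := fun h => by rw [← h]; ring
  have hn : c.val + 1 = n → n * m = c.val * m + m := fun h => by
    conv_lhs => rw [← h]
    ring
  have h0 : c'.val = 0 → c'.val * m = 0 := fun h => by rw [h, zero_mul]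
  cases h <;> simp only [selectorPotential, ColRel.Holds] at * <;> grind

/-- The path visits each of the n * m positions once, whatever column a is selected, and the
potential counts these visits. -/
theorem selector_isShortest (z a : Fin n) (i : Fin k) (hm : 0 < m) :
    (gadget src G).IsShortestPathFromTo (.s (.inl i), z) (.t (.inl i), z)
      ((List.range (n * m + 2)).map (selectorVertex (m := m) z a i)) := by
  have key := (gadget src G).isShortestPathFromTo_of_potential (selectorPotential i)
    (selectorPotential_le src G i) (n * m + 1) (selectorVertex z a i) ?_ ?_
  · rwa [selectorVertex_zero, selectorVertex_end] at key
  · intro x hx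
    rcases Nat.eq_zero_or_pos x with rfl | hx0
    · have h1 := selectorVertex_succ z a i ⟨0, z.pos⟩ (⟨0, hm⟩ : Fin m)
      simp only [zero_mul, zero_add] at h1
      rw [zero_add, h1, selectorVertex_zero]
      refine ⟨.fst, ?_, rfl⟩
      unfold selectorRow
      split_ifs with h2 h3
      · exact .s_inn _ _ rfl
      · exact .s_mid _ _ rfl
      · exact absurd (Fin.ext_iff.not.1 h3) (by simp only [Fin.lt_def] at h2; simp only; omega)
    · obtain ⟨c, l, hcl⟩ := exists_mul_add (a := n) (b := m) (x := x - 1) (by omega)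
      obtain rfl : x = c * m + l + 1 := by omega
      rw [selectorVertex_succ]
      by_cases hl : l.val + 1 < m
      · have h1 := selectorVertex_succ z a i c ⟨l + 1, hl⟩
        simp only [← add_assoc] at h1
        rw [h1]
        refine ⟨.same, ?_, rfl⟩
        unfold selectorRow
        split_ifs with h2 h3
        · exact .inn_same _ _ _ rfl
        · exact .mid_same _ _ _ rfl
        · exact .out_same _ _ _ rfl
      · have hl' : l.val + 1 = m := by omega
        by_cases hc : c.val + 1 < n
        · have h1 := selectorVertex_succ z a i ⟨c + 1, hc⟩ (⟨0, hm⟩ : Fin m)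
          simp only [add_zero] at h1
          have h2 : c.val * m + l + 1 + 1 = (c + 1) * m + 1 := by rw [add_assoc _ l.val, hl']; ring
          rw [h2, h1]
          refine ⟨.succ, ?_, rfl⟩
          unfold selectorRow
          -- The row can change only between columns: to `mid` on entering column a, and to `out` on
          -- leaving it.
          rcases lt_trichotomy c.val a.val with h3 | h3 | h3
          · rw [if_pos (by omega)]
            by_cases h4 : c.val + 1 = a.val
            · rw [if_neg (by simp only [Fin.lt_def]; omega), if_pos (Fin.ext h4)]
              exact .inn_mid _ _ _ hl' rfl
            · rw [if_pos (by simp only [Fin.lt_def]; omega)]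
              exact .inn_succ _ _ _ hl' rfl
          · rw [if_neg (by omega), if_pos (Fin.ext h3), if_neg (by simp only [Fin.lt_def]; omega),
              if_neg (by simp only [Fin.ext_iff]; omega)]
            exact .mid_out _ _ _ hl' rfl
          · rw [if_neg (by omega), if_neg (by omega), if_neg (by simp only [Fin.lt_def]; omega),
              if_neg (by simp only [Fin.ext_iff]; omega)]
            exact .out_succ _ _ _ hl' rfl
        · have hc' : c.val + 1 = n := by omega
          have h2 : c.val * m + l + 1 + 1 = n * m + 1 := by
            have h3 : n * m = (c + 1) * m := by rw [hc']
            rw [h3, add_assoc _ l.val, hl']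
            ring
          rw [h2, selectorVertex_end]
          refine ⟨.lst, ?_, hc'⟩
          unfold selectorRow
          rw [if_neg (by omega)]
          split_ifs
          · exact .mid_t _ _ hl'
          · exact .out_t _ _ hl'
  · intro x hx
    rcases Nat.eq_zero_or_pos x with rfl | hx0
    · simp [selectorVertex_zero, selectorPotential]
    · rcases hx.lt_or_eq with hx | rfl
      · obtain ⟨c, l, hcl⟩ := exists_mul_add (a := n) (b := m) (x := x - 1) (by omega)
        obtain rfl : x = c * m + l + 1 := by omega
        rw [selectorVertex_succ]
        unfold selectorRow
        split_ifs <;> simp [selectorPotential]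
      · simp [selectorVertex_end, selectorPotential]

/-- The path spends exactly two vertices in each part, on or off its chain. The clique supplies the
arcs into the parts on the chain, since `src l i` is smaller than the new part. -/
theorem check_isShortest (hk : 0 < k) (h0 : ∀ (l : Fin m) (i : Fin k), i.val = 0 → src l i = i)
    (hle : ∀ l i, src l i ≤ i)
    (hstep : ∀ (l : Fin m) (i j : Fin k), j.val = i.val + 1 → src l j = j ∨ src l j = src l i)
    (z : Fin n) (a : Fin k → Fin n) (ha : ∀ i j, i < j → G.Adj (i, a i) (j, a j)) (l : Fin m) :
    (gadget src G).IsShortestPathFromTo (.s (.inr l), z) (.t (.inr l), z)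
      ((List.range (k * 2 + 2)).map (checkVertex src z a l)) := by
  have key := (gadget src G).isShortestPathFromTo_of_potential checkPotential
    (checkPotential_le src G) (k * 2 + 1) (checkVertex src z a l) ?_ ?_
  · rwa [checkVertex_zero, checkVertex_end] at key
  · intro x hx
    rcases Nat.eq_zero_or_pos x with rfl | hx0
    · have h1 := checkVertex_succ src z a l ⟨0, hk⟩ 0
      simp only [zero_mul, zero_add, Fin.val_zero] at h1
      rw [zero_add, h1, checkVertex_zero, checkRow, if_pos (h0 _ _ rfl), if_pos rfl]
      exact ⟨.all, .s_check _ _ rfl, trivial⟩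
    · obtain ⟨i, b, hib⟩ := exists_mul_add (a := k) (b := 2) (x := x - 1) (by omega)
      obtain rfl : x = i * 2 + b + 1 := by omega
      rw [checkVertex_succ]
      by_cases hb : b = 0
      · subst hb
        have h1 := checkVertex_succ src z a l i 1
        simp only [Fin.val_one] at h1
        simp only [Fin.val_zero, add_zero]
        rw [h1]
        refine ⟨.same, ?_, rfl⟩
        rw [checkRow_zero, checkRow_one]
        split_ifs
        · exact .inn_out _ _
        · exact .cin_cout _ _
      · obtain rfl : b = 1 := by omega
        simp only [Fin.val_one]
        by_cases hi : i.val + 1 < k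
        · have h1 := checkVertex_succ src z a l ⟨i + 1, hi⟩ 0
          simp only [Fin.val_zero, add_zero] at h1
          rw [show i.val * 2 + 1 + 1 + 1 = (i + 1) * 2 + 1 by ring, h1]
          rw [checkRow_zero, checkRow_one]
          by_cases hj : src l ⟨i + 1, hi⟩ = ⟨i + 1, hi⟩
          · rw [if_pos hj, hj]
            have hlt : src l i < ⟨i + 1, hi⟩ := by
              have := hle l i
              simp only [Fin.lt_def, Fin.le_def] at *
              omega
            split_ifs with hs
            · exact ⟨_, .out_inn i _ l rfl hs hj, by
                have := ha _ _ hlt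
                rw [hs] at this ⊢
                exact this⟩
            · exact ⟨_, .cout_inn i _ l rfl hj, ha _ _ hlt⟩
          · have hs' := (hstep l i ⟨i + 1, hi⟩ rfl).resolve_left hj
            rw [if_neg hj, hs']
            split_ifs with hs
            · exact ⟨.same, .out_cin i _ l rfl hs hs' hj, rfl⟩
            · exact ⟨.same, .cout_cin i _ l rfl hs' hj, rfl⟩
        · have hi' : i.val + 1 = k := by omega
          rw [show i.val * 2 + 1 + 1 + 1 = k * 2 + 1 by omega, checkVertex_end]
          refine ⟨.all, ?_, trivial⟩
          rw [checkRow_one]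
          split_ifs with hs
          · exact .out_end _ _ hi' hs
          · exact .cout_end _ _ hi'
  · intro x hx
    rcases Nat.eq_zero_or_pos x with rfl | hx0
    · simp [checkVertex_zero, checkPotential]
    · rcases hx.lt_or_eq with hx | rfl
      · obtain ⟨i, b, hib⟩ := exists_mul_add (a := k) (b := 2) (x := x - 1) (by omega)
        obtain rfl : x = i * 2 + b + 1 := by omega
        rw [checkVertex_succ]
        unfold checkRow
        split_ifs <;> simp only [checkPotential] <;> omega
      · simp only [checkVertex_end, checkPotential]
        ring

/-- A clique yields disjoint shortest paths. -/
theorem exists_paths_of_clique (hk : 0 < k) (hm : 0 < m)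
    (h0 : ∀ (l : Fin m) (i : Fin k), i.val = 0 → src l i = i)
    (hle : ∀ l i, src l i ≤ i)
    (hstep : ∀ (l : Fin m) (i j : Fin k), j.val = i.val + 1 → src l j = j ∨ src l j = src l i)
    (z : Fin n) (a : Fin k → Fin n) (ha : ∀ i j, i < j → G.Adj (i, a i) (j, a j)) :
    ∃ P : Fin k ⊕ Fin m → List (Row k m × Fin n),
      (∀ x, (gadget src G).IsShortestPathFromTo (.s x, z) (.t x, z) (P x)) ∧
        InternallyDisjoint P := by
  let P : Fin k ⊕ Fin m → List (Row k m × Fin n)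
    | .inl i => (List.range (n * m + 2)).map (selectorVertex z (a i) i)
    | .inr l => (List.range (k * 2 + 2)).map (checkVertex src z a l)
  have howner : ∀ x, ∀ v ∈ P x, owner a v = x := by
    rintro (i | l) v hv
    · obtain ⟨x, -, rfl⟩ := List.mem_map.1 hv
      exact owner_selectorVertex z a i x
    · obtain ⟨x, -, rfl⟩ := List.mem_map.1 hv
      exact owner_checkVertex src z a l x
  refine ⟨P, ?_, ?_⟩
  · rintro (i | l)
    · exact selector_isShortest src G z (a i) i hm
    · exact check_isShortest src G hk h0 hle hstep z a ha l
  · intro x y hxy v hv hv'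
    have hv : v ∈ P x := List.mem_of_mem_tail (List.mem_of_mem_dropLast hv)
    exact hxy ((howner x v hv).symm.trans (howner y v hv'))

end Completeness

/-! ### Covering all pairs by chains -/

/-- The last element that is at most `i` of the chain `0, 1, …, r, r + d, r + 2 * d, …`. -/
def chainFloor (r d i : ℕ) : ℕ := if i ≤ r then i else r + d * ((i - r) / d)

theorem chainFloor_of_le {r d i : ℕ} (h : r ≤ i) :
    chainFloor r d i = r + d * ((i - r) / d) := by
  unfold chainFloor
  split_ifs with h'
  · obtain rfl : i = r := by omega
    simp
  · rfl

theorem chainFloor_le (r d i : ℕ) : chainFloor r d i ≤ i := by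
  unfold chainFloor
  split_ifs with h
  · exact le_rfl
  · have := Nat.mul_div_le (i - r) d
    omega

theorem chainFloor_succ (r d i : ℕ) :
    chainFloor r d (i + 1) = i + 1 ∨ chainFloor r d (i + 1) = chainFloor r d i := by
  by_cases h : i + 1 ≤ r
  · exact .inl (if_pos h)
  · rw [chainFloor_of_le (by omega : r ≤ i + 1), chainFloor_of_le (by omega : r ≤ i),
      show i + 1 - r = i - r + 1 by omega, Nat.succ_div]
    split_ifs with hdvd
    · left
      have h1 := Nat.div_mul_cancel hdvd
      rw [Nat.succ_div_of_dvd hdvd] at h1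
      rw [mul_comm, h1]
      omega
    · right
      rfl

/-- The number i lies on the progression starting at i % d, and the next term is i + d. -/
theorem chainFloor_of_lt {i d x : ℕ} (h : x < d) : chainFloor (i % d) d (i + x) = i := by
  have h1 := Nat.mod_le i d
  have h2 := Nat.div_add_mod i d
  rw [chainFloor_of_le (by omega), show i + x - i % d = d * (i / d) + x by omega,
    Nat.mul_add_div (by omega), Nat.div_eq_of_lt h, add_zero]
  omega

theorem chainFloor_add {i d : ℕ} (hd : 0 < d) : chainFloor (i % d) d (i + d) = i + d := by
  simpa using chainFloor_of_lt (i := i + d) hd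

/-- From k to k + 2 both sides grow by k + 1: after a shift of r, the new terms are k + 1 at r = 0
and a truncated 0 at the end. -/
theorem sum_range_sub_two_mul (k : ℕ) : ∑ r ∈ Finset.range k, (k - 2 * r - 1) = k ^ 2 / 4 := by
  induction k using Nat.twoStepInduction with
  | zero => simp
  | one => simp
  | more k ih _ =>
    rw [Finset.sum_range_succ', Finset.sum_range_succ,
      Finset.sum_congr rfl fun r _ => (by omega : k + 2 - 2 * (r + 1) - 1 = k - 2 * r - 1), ih,
      show (k + 2) ^ 2 = k ^ 2 + (k + 1) * 4 by ring, Nat.add_mul_div_right _ _ (by norm_num)]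
    omega

/-- The pairs of numbers below `k` can be covered by `k ^ 2 / 4` increasing chains, such that every
pair consists of consecutive elements of one of the chains. -/
theorem exists_chains (k : ℕ) : ∃ src : Fin (k ^ 2 / 4) → Fin k → Fin k,
    (∀ l (i : Fin k), i.val = 0 → src l i = i) ∧ (∀ l i, src l i ≤ i) ∧
    (∀ l (i j : Fin k), j.val = i.val + 1 → src l j = j ∨ src l j = src l i) ∧
    ∀ i j : Fin k, i < j → ∃ l, ∃ j' : Fin k, j'.val + 1 = j ∧ src l j' = i ∧ src l j = j := by
  -- A pair (r, y) encodes the progression with start r and second term y, so d = y - r. Here 2 * r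
  -- < y says that r < d, and y < k that two terms lie below k. The steps 0, …, r before it let
  -- every chain begin at part 0.
  let S : Finset (Σ _ : ℕ, ℕ) := (Finset.range k).sigma fun r => Finset.Ioo (2 * r) k
  have hS : S.card = k ^ 2 / 4 := by
    simp only [S, Finset.card_sigma, Nat.card_Ioo, sum_range_sub_two_mul]
  let f := (S.equivFinOfCardEq hS).symm
  refine ⟨fun l i => ⟨chainFloor (f l).1.1 ((f l).1.2 - (f l).1.1) i,
    (chainFloor_le _ _ _).trans_lt i.2⟩, fun l i hi => ?_, fun l i => chainFloor_le _ _ _,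
    fun l i j hij => ?_, fun i j hij => ?_⟩
  · ext
    simp [hi, chainFloor]
  · simp only [Fin.ext_iff, hij]
    exact chainFloor_succ _ _ _
  · have hlt : i.val < j.val := hij
    have hmod := Nat.mod_lt i.val (by omega : 0 < j.val - i.val)
    have hmod' := Nat.mod_le i.val (j.val - i.val)
    let x : Σ _ : ℕ, ℕ := ⟨i % (j - i), i % (j - i) + (j - i)⟩
    have hx : x ∈ S := by
      simp only [S, x, Finset.mem_sigma, Finset.mem_range, Finset.mem_Ioo]
      omega
    -- At part j - 1 the chain with difference j - i still carries i, and at part j it moves to j.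
    refine ⟨f.symm ⟨x, hx⟩, ⟨j - 1, by omega⟩, by simp only; omega, ?_, ?_⟩
    · ext
      simp only [Equiv.apply_symm_apply, x, Nat.add_sub_cancel_left]
      have := chainFloor_of_lt (i := i) (d := j - i) (x := j - 1 - i) (by omega)
      rwa [show i.val + (j - 1 - i) = j - 1 by omega] at this
    · ext
      simp only [Equiv.apply_symm_apply, x, Nat.add_sub_cancel_left]
      have := chainFloor_add (i := i) (d := j - i) (by omega)
      rwa [show i.val + (j - i) = j by omega] at this

/-! ### The reduction -/

/-- A clique has at most one vertex in each part, so k vertices meet each of the k parts exactly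
once. -/
theorem exists_isNClique_iff {k n : ℕ} {G : SimpleGraph (Fin k × Fin n)} (hG : IsPartiteByFst G) :
    (∃ S : Finset (Fin k × Fin n), G.IsNClique k S) ↔
      ∃ a : Fin k → Fin n, ∀ i j, i < j → G.Adj (i, a i) (j, a j) := by
  constructor
  · rintro ⟨S, hS⟩
    have hinj : Set.InjOn Prod.fst (S : Set (Fin k × Fin n)) := by
      intro u hu v hv huv
      by_contra hne
      exact hG u v (hS.1 hu hv hne) huv
    have himg : S.image Prod.fst = Finset.univ := by
      rw [← Finset.card_eq_iff_eq_univ, Finset.card_image_of_injOn hinj, hS.2, Fintype.card_fin]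
    have hex : ∀ i : Fin k, ∃ c : Fin n, (i, c) ∈ S := by
      intro i
      have hi : i ∈ S.image Prod.fst := himg ▸ Finset.mem_univ i
      obtain ⟨⟨j, c⟩, hu, rfl⟩ := Finset.mem_image.1 hi
      exact ⟨c, hu⟩
    choose a ha using hex
    exact ⟨a, fun i j hij => hS.1 (ha i) (ha j) fun h => hij.ne (congrArg Prod.fst h)⟩
  · rintro ⟨a, ha⟩
    refine ⟨Finset.univ.image fun i => (i, a i), ?_, ?_⟩
    · intro u hu v hv huv
      obtain ⟨i, -, rfl⟩ := Finset.mem_image.1 hu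
      obtain ⟨j, -, rfl⟩ := Finset.mem_image.1 hv
      rcases lt_trichotomy i j with h | rfl | h
      · exact ha i j h
      · exact absurd rfl huv
      · exact (ha j i h).symm
    · rw [Finset.card_image_of_injective _ fun i j h => congrArg Prod.fst h, Finset.card_univ,
        Fintype.card_fin]

/-- An instance whose graph is isomorphic to the gadget has a solution if and only if the input
graph has a clique. -/
theorem DPInstance.solution_iff_clique {k n : ℕ} (hk : 3 ≤ k)
    {src : Fin (k ^ 2 / 4) → Fin k → Fin k}
    (h0 : ∀ l (i : Fin k), i.val = 0 → src l i = i) (hle : ∀ l i, src l i ≤ i)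
    (hstep : ∀ l (i j : Fin k), j.val = i.val + 1 → src l j = j ∨ src l j = src l i)
    (hsrc : ∀ i j : Fin k, i < j → ∃ l, ∃ j' : Fin k, j'.val + 1 = j ∧ src l j' = i ∧ src l j = j)
    (G : SimpleGraph (Fin k × Fin n)) (z : Fin n) (I : DPInstance (k + k ^ 2 / 4))
    (e : Fin I.N ≃ Row k (k ^ 2 / 4) × Fin n)
    (hadj : ∀ u v, I.G.Adj u v ↔ (gadget src G).Adj (e u) (e v))
    (hs : ∀ x, e (I.s (finSumFinEquiv x)) = (.s x, z))
    (ht : ∀ x, e (I.t (finSumFinEquiv x)) = (.t x, z)) :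
    ((∃ a : Fin k → Fin n, ∀ i j, i < j → G.Adj (i, a i) (j, a j)) →
      I.HasDisjointShortestPaths) ∧
    (I.HasDisjointPaths → ∃ a : Fin k → Fin n, ∀ i j, i < j → G.Adj (i, a i) (j, a j)) := by
  constructor
  · rintro ⟨a, ha⟩
    have hm : 0 < k ^ 2 / 4 := Nat.div_pos (by nlinarith) (by norm_num)
    obtain ⟨P, hP, hdis⟩ := exists_paths_of_clique src G (by omega) hm h0 hle hstep z a ha
    have hdis' := hdis.map e.symm e.symm.injective
    refine ⟨fun i => (P (finSumFinEquiv.symm i)).map e.symm, fun i => ?_,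
      fun i j hij => hdis' _ _ (finSumFinEquiv.symm.injective.ne hij)⟩
    obtain ⟨x, rfl⟩ := finSumFinEquiv.surjective i
    have := (hP x).map_equiv e.symm (H := I.G) fun u v => by simp [hadj]
    rw [← hs, ← ht, e.symm_apply_apply, e.symm_apply_apply] at this
    simpa only [Equiv.symm_apply_apply] using this
  · rintro ⟨P, hP, hdis⟩
    refine exists_clique_of_paths src G hsrc (z := z)
      (P := fun x => (P (finSumFinEquiv x)).map e) (fun x => ?_)
      fun x y hxy => hdis.map e e.injective _ _ (finSumFinEquiv.injective.ne hxy)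
    have := (hP (finSumFinEquiv x)).map e e.injective fun u v => (hadj u v).1
    rwa [hs, ht] at this

theorem DPInstance.HasDisjointShortestPaths.hasDisjointPaths {p : ℕ} {I : DPInstance p}
    (h : I.HasDisjointShortestPaths) : I.HasDisjointPaths :=
  let ⟨P, hP, hdis⟩ := h
  ⟨P, fun i => (hP i).1, hdis⟩

/-- The reduction works for all problems between disjoint shortest paths and disjoint paths. -/
theorem cliqueReducesTo_of_imp (k : ℕ) (hk : 3 ≤ k) (Q : DPInstance (k + k ^ 2 / 4) → Prop)
    (hQ : ∀ I, I.HasDisjointShortestPaths → Q I) (hQ' : ∀ I, Q I → I.HasDisjointPaths) :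
    CliqueReducesTo k (k + k ^ 2 / 4) Q := by
  obtain ⟨src, h0, hle, hstep, hsrc⟩ := exists_chains k
  obtain ⟨L, ⟨e⟩⟩ := Finite.exists_equiv_fin (Row k (k ^ 2 / 4))
  have hL : 0 < L := (e (.s (.inl ⟨0, by omega⟩))).pos
  -- Rows and column relations are finite in number for fixed k, so the arcs form a finite list that
  -- does not depend on n or G and can be built into the program.
  let A : Set (Fin L × Fin L × ColRel k) := {x | Arc src (e.symm x.1) (e.symm x.2.1) x.2.2}
  let E := (Set.toFinite A).toFinset.toList
  have hE : ∀ x, x ∈ E ↔ Arc src (e.symm x.1) (e.symm x.2.1) x.2.2 := fun x => by simp [E, A]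
  let s : Fin (k + k ^ 2 / 4) → Fin L := fun i => e (.s (finSumFinEquiv.symm i))
  let t : Fin (k + k ^ 2 / 4) → Fin L := fun i => e (.t (finSumFinEquiv.symm i))
  obtain ⟨prog, c, C, hprog⟩ := WordRAM.exists_templateProg (k := k) (by omega) hL E s t
  refine ⟨prog, c, C, fun n hn w hw G hG => ?_⟩
  obtain ⟨σ, T, hrun, hT, hstored, hN⟩ := hprog n hn w hw G
  let I := templateInstance E s t hn G
  let ε : Fin I.N ≃ Row k (k ^ 2 / 4) × Fin n :=
    finProdFinEquiv.symm.trans (e.symm.prodCongr (Equiv.refl _))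
  have hadj : ∀ u v, I.G.Adj u v ↔ (gadget src G).Adj (ε u) (ε v) := by
    intro u v
    constructor
    · rintro ⟨⟨x, y, R⟩, hx, rfl, rfl, hR⟩
      exact ⟨R, (hE _).1 hx, hR⟩
    · rintro ⟨R, hx, hR⟩
      exact ⟨(Fin.divNat u, Fin.divNat v, R), (hE _).2 hx, rfl, rfl, hR⟩
  have hε : ∀ (r : Fin L) (c : Fin n), ε (finProdFinEquiv (r, c)) = (e.symm r, c) := by
    intro r c
    change (e.symm.prodCongr (Equiv.refl _)) (finProdFinEquiv.symm (finProdFinEquiv (r, c))) = _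
    rw [Equiv.symm_apply_apply]
    rfl
  have hs : ∀ x, ε (I.s (finSumFinEquiv x)) = (.s x, ⟨0, hn⟩) := fun x =>
    (hε _ _).trans (by simp [s])
  have ht : ∀ x, ε (I.t (finSumFinEquiv x)) = (.t x, ⟨0, hn⟩) := fun x =>
    (hε _ _).trans (by simp [t])
  have hsol := DPInstance.solution_iff_clique hk h0 hle hstep hsrc G ⟨0, hn⟩ I ε hadj hs ht
  refine ⟨σ, T, I, hrun, hT, hstored, hN, ?_, ?_, ?_⟩
  · intro v hv
    exact gadget_isDAG src G (ε v) (hv.lift ε fun a b => (hadj a b).1)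
  · have : ∀ x y : (Fin (k + k ^ 2 / 4)) ⊕ (Fin (k + k ^ 2 / 4)),
        ε (Sum.elim I.s I.t x) = ε (Sum.elim I.s I.t y) → x = y := by
      rintro (x | x) (y | y) h <;> obtain ⟨x, rfl⟩ := finSumFinEquiv.surjective x <;>
        obtain ⟨y, rfl⟩ := finSumFinEquiv.surjective y <;>
        simp only [Sum.elim_inl, Sum.elim_inr, hs, ht] at h <;> simp_all
    exact fun x y h => this x y (congrArg ε h)
  · rw [exists_isNClique_iff hG]
    -- The chain of implications closes: clique, disjoint shortest paths, `Q`, disjoint paths,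
    -- clique.
    exact ⟨fun h => hQ I (hsol.1 h), fun h => hsol.2 (hQ' I h)⟩

theorem theorem8 (k : ℕ) (hk : 3 ≤ k) :
    CliqueReducesTo k (k + k ^ 2 / 4) DPInstance.HasDisjointPaths ∧
      CliqueReducesTo k (k + k ^ 2 / 4) DPInstance.HasDisjointShortestPaths :=
  ⟨cliqueReducesTo_of_imp k hk _ (fun _ h => h.hasDisjointPaths) fun _ h => h,
    cliqueReducesTo_of_imp k hk _ (fun _ h => h) fun _ h => h.hasDisjointPaths⟩
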